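/- **Setting.** Let $r\ge 0$, $\mu,\sigma,\rho,\delta>0$ and $0<\alpha\le 1$. Let $U_+,U_-:[0,\infty)\to\mathbb R$ be continuous, twice continuously differentiable on $(0,\infty)$, with $U_\pm'>0$, $U_\pm''<0$ on $(0,\infty)$, $U_\pm'(+\infty)=0$ and $U_\pm(0)=0$; put $U_\pm'(0):=\lim_{x\to0+}U_\pm'(x)\in(0,+\infty]$ and assume $U_-(\alpha)\le\alpha\,U_+'(0)$. Let $U(c)=U_+(c-\alpha)$ for $c>\alpha$ and $U(c)=-U_-(\alpha-c)$ for $0\le c\le\alpha$. Let $c_0\ge\alpha$ be the unique solution of $c_0U_+'(c_0-\alpha)-U_+(c_0-\alpha)=U_-(\alpha)$, let $\phi_0:=U_+'(c_0-\alpha)$, let $(U_+')^{-1}$ be the inverse function of $U_+'$, and set $$G(\phi):=U_+\big((U_+')^{-1}(\phi)\big)-\phi\big(\alpha+(U_+')^{-1}(\phi)\big),\qquad 0<\phi\le\phi_0,$$ $$\lambda:=\frac{\sigma^2}{\mu^2}\left(\frac{\mu^2}{2\sigma^2}+r+\rho-\delta-\sqrt{\Big(\frac{\mu^2}{2\sigma^2}+r+\rho-\delta\Big)^2+2\delta\frac{\mu^2}{\sigma^2}}\right)<0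 .$$ **Theorem 3.1.** (i) There exist a constant $y_0\in\left(\frac{\phi_0\lambda}{\lambda-1},\phi_0\right)$, a strictly increasing function $\varphi:(0,y_0]\to(0,\phi_0]$ with $\varphi<\phi_0$ on $(0,y_0)$, and a function $\psi:(0,y_0]\to(0,1)$ such that, for $0<y\le y_0$ (with one-sided derivatives at $y_0$), $$\varphi'(y)=\frac1y\,\varphi(y)\big(1-\psi(y)\big),$$ $$\psi'(y)=-\frac{2\rho\sigma^2}{\mu^2}\left[\frac{1-\psi(y)}{y}\left(\frac{\mu^2}{2\rho\sigma^2}\psi(y)-(U_+')^{-1}\big(\varphi(y)\big)+\frac{r-\delta}{\rho}+1-\alpha\right)-\frac{r+\rho}{\rho\,\varphi(y)}+\frac{\delta}{\rho y}\right],$$ with the free-boundary conditions $$\varphi(y_0)=\phi_0,\qquad \psi(y_0)=\frac{2\sigma^2}{\phi_0\mu^2}\left(\frac{\delta}{\lambda}+r+\rho-\delta\right)(y_0-\phi_0).$$ Moreover, for every such $(y_0,\varphi,\psi)$ the limit $\varphi(0+):=\lim_{y\to0+}\varphi(y)$ exists, and $\varphi(0+)>0$ or $\lim_{y\to0+}\psi(y)=1$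 (or both). (ii) For every $(y_0,\varphi,\psi)$ as in (i), define $$u(y):=\frac1\delta\left[\frac{\mu^2}{2\rho\sigma^2}\varphi(y)\psi(y)+G\big(\varphi(y)\big)+\frac{\delta-r-\rho}{\rho}\big(y-\varphi(y)\big)\right],\qquad 0<y\le y_0 .$$ Then $u\in C^2((0,y_0])$, $0<y-\rho y u'(y)\le\phi_0$ on $(0,y_0]$, and $(u,y_0)$ solves the free-boundary problem $$\frac{\mu^2}{2\sigma^2}y^2u''(y)+G\big(y-\rho yu'(y)\big)+(\delta-r-\rho)yu'(y)-\delta u(y)=0,\qquad 0<y\le y_0,$$ $$y_0-\rho y_0u'(y_0)=\phi_0,\qquad u(y_0)=\frac{y_0-\phi_0}{\rho\lambda}+\frac{U(0)}{\delta}.$$ Furthermore, for $0<y<y_0$, $$u'(y)=\frac{y-\varphi(y)}{\rho y},\qquad u''(y)=\frac{1}{\rho y^2}\varphi(y)\psi(y),$$ $u$ is strictly decreasing and strictly convex on $(0,y_0)$, and $\lim_{y\to0+}u'(y)=-\infty$. -/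

import Mathlib

open Set Filter Topology

noncomputable section

/-- Utility functions: continuous on `[0, ∞)`, twice continuously differentiable on `(0, ∞)`, with
`f' > 0`, `f'' < 0`, `f'(+∞) = 0` and `f(0) = 0`. An infinite slope at the origin is allowed (power
utilities). Only the values of `f` on `[0, ∞)` matter. -/
structure IsUtility (f : ℝ → ℝ) : Prop where
  continuousOn : ContinuousOn f (Ici 0)
  contDiffOn : ContDiffOn ℝ 2 f (Ioi 0)
  deriv_pos : ∀ x, 0 < x → 0 < deriv f x
  deriv_deriv_neg : ∀ x, 0 < x → deriv (deriv f) x < 0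
  tendsto_deriv : Tendsto (deriv f) atTop (𝓝 0)
  map_zero : f 0 = 0

/-- The slope `f'(0) = f'(0+)` at the origin, in the extended reals: the limit of `f'(x)` as `x ↓ 0`
(it exists for a utility function, whose derivative is decreasing, and may be `+∞`). -/
def slopeAtZero (f : ℝ → ℝ) : EReal :=
  limUnder (𝓝[>] (0 : ℝ)) (fun x => ((deriv f x : ℝ) : EReal))

/-- The marginal utility `f'` on `[0, ∞)`: the derivative for `x > 0`, the right derivative at
`x = 0` (where it takes the value `0` if the slope at the origin is infinite). -/
def marginal (f : ℝ → ℝ) (x : ℝ) : ℝ := derivWithin f (Ici 0) x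

/-- The inverse `(f')⁻¹` of the marginal utility: the `x ≥ 0` with `f'(x) = p`. -/
def marginalInv (f : ℝ → ℝ) (p : ℝ) : ℝ := Function.invFunOn (marginal f) (Ici 0) p

/-- The data of the model: interest rate `r`, excess return `μ`, volatility `σ`, habit persistence
`ρ`, discount rate `δ`, reference point `α`, gain utility `Up` and loss utility `Um`. -/
structure HabitModel where
  r : ℝ
  μ : ℝ
  σ : ℝ
  ρ : ℝ
  δ : ℝ
  α : ℝ
  Up : ℝ → ℝ
  Um : ℝ → ℝ

namespace HabitModel

variable (M : HabitModel)

/-- The S-shaped utility. -/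
def U (c : ℝ) : ℝ := if M.α < c then M.Up (c - M.α) else -M.Um (M.α - c)

/-- The set of solutions `c ≥ α` of `c U₊'(c - α) - U₊(c - α) = U₋(α)`. -/
def tangencySet : Set ℝ :=
  {c | M.α ≤ c ∧ c * marginal M.Up (c - M.α) - M.Up (c - M.α) = M.Um M.α}

/-- The number `c₀`, the solution `c ≥ α` of `c U₊'(c - α) - U₊(c - α) = U₋(α)` (there is exactly
one when `U₋(α) ≤ α U₊'(0)`). -/
def c₀ : ℝ := sInf M.tangencySet

/-- `φ₀ = U₊'(c₀ - α)`. -/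
def φ₀ : ℝ := marginal M.Up (M.c₀ - M.α)

/-- `G(p) = U₊((U₊')⁻¹(p)) - p (α + (U₊')⁻¹(p))`, used for `0 < p ≤ φ₀`. -/
def G (p : ℝ) : ℝ := M.Up (marginalInv M.Up p) - p * (M.α + marginalInv M.Up p)

/-- The negative root `λ` of
`(μ² / (2 σ²)) x² - (μ² / (2 σ²) + r + ρ - δ) x - δ = 0`. -/
def lam : ℝ :=
  M.σ ^ 2 / M.μ ^ 2 *
    (M.μ ^ 2 / (2 * M.σ ^ 2) + M.r + M.ρ - M.δ
      - √((M.μ ^ 2 / (2 * M.σ ^ 2) + M.r + M.ρ - M.δ) ^ 2 + 2 * M.δ * (M.μ ^ 2 / M.σ ^ 2)))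

/-- `(φ, ψ, y₀)` solves the coupled first-order free-boundary problem on `(0, y₀]`
(one-sided derivatives at `y₀`). -/
structure IsSystemSolution (y₀ : ℝ) (φ ψ : ℝ → ℝ) : Prop where
  mem_y₀ : y₀ ∈ Ioo (M.φ₀ * M.lam / (M.lam - 1)) M.φ₀
  mem_φ : ∀ y ∈ Ioc 0 y₀, φ y ∈ Ioc 0 M.φ₀
  φ_lt : ∀ y ∈ Ioo 0 y₀, φ y < M.φ₀
  mono_φ : StrictMonoOn φ (Ioc 0 y₀)
  mem_ψ : ∀ y ∈ Ioc 0 y₀, ψ y ∈ Ioo 0 1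
  ode_φ : ∀ y ∈ Ioc 0 y₀, HasDerivWithinAt φ (1 / y * φ y * (1 - ψ y)) (Ioc 0 y₀) y
  ode_ψ : ∀ y ∈ Ioc 0 y₀, HasDerivWithinAt ψ
    (-(2 * M.ρ * M.σ ^ 2 / M.μ ^ 2) *
      ((1 - ψ y) / y *
          (M.μ ^ 2 / (2 * M.ρ * M.σ ^ 2) * ψ y - marginalInv M.Up (φ y)
            + (M.r - M.δ) / M.ρ + 1 - M.α)
        - (M.r + M.ρ) / (M.ρ * φ y) + M.δ / (M.ρ * y))) (Ioc 0 y₀) y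
  boundary_φ : φ y₀ = M.φ₀
  boundary_ψ : ψ y₀ =
    2 * M.σ ^ 2 / (M.φ₀ * M.μ ^ 2) * (M.δ / M.lam + M.r + M.ρ - M.δ) * (y₀ - M.φ₀)

/-- The function `u` built from `(φ, ψ)`. -/
def dualFun (φ ψ : ℝ → ℝ) (y : ℝ) : ℝ :=
  1 / M.δ * (M.μ ^ 2 / (2 * M.ρ * M.σ ^ 2) * φ y * ψ y + M.G (φ y)
    + (M.δ - M.r - M.ρ) / M.ρ * (y - φ y))

/-- `(u, y₀)` is a classical solution of the reduced dual free-boundary problem on `(0, y₀]`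
(one-sided derivatives at `y₀`). -/
structure IsReducedDualSolution (u : ℝ → ℝ) (y₀ : ℝ) : Prop where
  y₀_pos : 0 < y₀
  contDiffOn : ContDiffOn ℝ 2 u (Ioc 0 y₀)
  /-- the argument of `G` stays in the domain `(0, φ₀]` of `G` -/
  mem_domain : ∀ y ∈ Ioc 0 y₀, y - M.ρ * y * derivWithin u (Ioc 0 y₀) y ∈ Ioc 0 M.φ₀
  equation : ∀ y ∈ Ioc 0 y₀,
    M.μ ^ 2 / (2 * M.σ ^ 2) * y ^ 2 * derivWithin (derivWithin u (Ioc 0 y₀)) (Ioc 0 y₀) y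
      + M.G (y - M.ρ * y * derivWithin u (Ioc 0 y₀) y)
      + (M.δ - M.r - M.ρ) * y * derivWithin u (Ioc 0 y₀) y - M.δ * u y = 0
  boundary_deriv : y₀ - M.ρ * y₀ * derivWithin u (Ioc 0 y₀) y₀ = M.φ₀
  boundary_value : u y₀ = (y₀ - M.φ₀) / (M.ρ * M.lam) + M.U 0 / M.δ

end HabitModel

end

/-! Put `κ = μ² / (2 σ²)`, `R = r + ρ`, `k = α + (U₊')⁻¹` and pass to logarithmic time `t = log (y₀
/ y)`. The system becomes `φ' = -φ (1 - ψ)` with an equation for `z = κ φ ψ`, and `0 < ψ < 1` says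
that the trajectory stays in the band `0 < z < κ φ`. The quadratic for `λ` turns the boundary value
of `ψ` into `(1 - λ) (φ₀ - y₀) / φ₀`. So `z` starts on the edge `z = 0` when `y₀ = φ₀`, and on the
edge `z = κ φ` when `y₀ = φ₀ λ / (λ - 1)`.

Existence is a shooting argument in `y₀`. At the two extreme values the trajectory leaves the band
at once, through opposite edges. If the field is clamped outside the band, a trajectory that has
left never returns (`z_neg_of_neg`, `gap_neg_of_neg`). The intermediate value theorem at time `T`
then yields a `y₀` that is good up to `T` (`nonempty_admissible`), and compactness yields one that
is good forever. Touching an edge is excluded by a second-order argument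
(`ne_zero_of_deriv_eq_add_mul`). Since `k` is only continuous up to `φ₀`, the field need not be
Lipschitz in `(φ, z)`. Subtracting from `z` a primitive of `ρ k + δ - R` evaluated at `φ` gives a
coordinate `β` with `β' = δ φ - R y₀ e⁻ᵗ`, and in `(φ, β)` the truncated field is Lipschitz.

Conversely, `u` is defined from `(φ, ψ)` by solving the second-order equation for `u`. The envelope
formula `G' = -k` and the equation for `ψ` give `u' = (1 - φ / y) / ρ` (`hasDerivWithinAt_dualFun`),
and the other claims on `u` follow from the behaviour of `φ / y`. Near `0`, either `φ` has a
positive limit, or `(U₊')⁻¹(φ)` blows up and drives `ψ` to `1`; in both cases `φ / y → ∞`. -/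

noncomputable section

/-! ### Concave utilities and the inverse of the marginal utility. -/

namespace IsUtility

variable {f : ℝ → ℝ}

theorem differentiableAt (hf : IsUtility f) {x : ℝ} (hx : 0 < x) : DifferentiableAt ℝ f x :=
  (hf.contDiffOn.contDiffAt (Ioi_mem_nhds hx)).differentiableAt (by norm_num)

theorem contDiffOn_deriv (hf : IsUtility f) : ContDiffOn ℝ 1 (deriv f) (Ioi 0) :=
  ((contDiffOn_succ_iff_deriv_of_isOpen (n := 1) isOpen_Ioi).1
    (by simpa [one_add_one_eq_two] using hf.contDiffOn)).2.2

theorem hasDerivAt_deriv (hf : IsUtility f) {x : ℝ} (hx : 0 < x) :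
    HasDerivAt (deriv f) (deriv (deriv f) x) x :=
  ((hf.contDiffOn_deriv.contDiffAt (Ioi_mem_nhds hx)).differentiableAt (by norm_num)).hasDerivAt

theorem strictAntiOn_deriv (hf : IsUtility f) : StrictAntiOn (deriv f) (Ioi 0) :=
  strictAntiOn_of_deriv_neg (convex_Ioi 0) hf.contDiffOn_deriv.continuousOn
    fun x hx => hf.deriv_deriv_neg x (by simpa using hx)

theorem strictConcaveOn (hf : IsUtility f) : StrictConcaveOn ℝ (Ici 0) f :=
  StrictAntiOn.strictConcaveOn_of_deriv (convex_Ici 0) hf.continuousOn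
    (by simpa using hf.strictAntiOn_deriv)

theorem strictMonoOn (hf : IsUtility f) : StrictMonoOn f (Ici 0) :=
  strictMonoOn_of_deriv_pos (convex_Ici 0) hf.continuousOn
    fun x hx => hf.deriv_pos x (by simpa using hx)

theorem pos (hf : IsUtility f) {x : ℝ} (hx : 0 < x) : 0 < f x := by
  simpa [hf.map_zero] using hf.strictMonoOn (mem_Ici.2 le_rfl) (mem_Ici.2 hx.le) hx

theorem marginal_eq_deriv {x : ℝ} (hx : 0 < x) : marginal f x = deriv f x :=
  derivWithin_of_mem_nhds (Ici_mem_nhds hx)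

/-- The points of `[0, ∞)` where the marginal utility is a genuine (positive) derivative. -/
def steep (f : ℝ → ℝ) : Set ℝ := {x | 0 ≤ x ∧ 0 < marginal f x}

theorem hasDerivWithinAt_of_mem_steep {x : ℝ} (hx : x ∈ steep f) :
    HasDerivWithinAt f (marginal f x) (Ici 0) x :=
  (differentiableWithinAt_of_derivWithin_ne_zero hx.2.ne').hasDerivWithinAt

theorem mem_steep_of_pos (hf : IsUtility f) {x : ℝ} (hx : 0 < x) : x ∈ steep f :=
  ⟨hx.le, marginal_eq_deriv (f := f) hx ▸ hf.deriv_pos x hx⟩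

theorem mem_steep_of_le (hf : IsUtility f) {x y : ℝ} (hx : x ∈ steep f) (h : x ≤ y) :
    y ∈ steep f := by
  rcases h.eq_or_lt with rfl | h
  · exact hx
  · exact hf.mem_steep_of_pos (hx.1.trans_lt h)

/-- The tangent line inequality. -/
theorem le_tangent (hf : IsUtility f) {x y : ℝ} (hx : x ∈ steep f) (hy : 0 ≤ y) :
    f y ≤ f x + marginal f x * (y - x) := by
  have hd := hasDerivWithinAt_of_mem_steep hx
  rcases lt_trichotomy x y with h | rfl | h
  · have := hf.strictConcaveOn.concaveOn.slope_le_of_hasDerivWithinAt hx.1 hy h hd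
    rw [slope_def_field, div_le_iff₀ (sub_pos.2 h)] at this
    linarith
  · simp
  · have := hf.strictConcaveOn.concaveOn.le_slope_of_hasDerivWithinAt hy hx.1 h hd
    rw [slope_def_field, le_div_iff₀ (sub_pos.2 h)] at this
    linarith

theorem strictAntiOn_marginal (hf : IsUtility f) : StrictAntiOn (marginal f) (steep f) :=
  fun _ hx _ hy h =>
    (hf.strictConcaveOn.lt_slope_of_hasDerivWithinAt hx.1 hy.1 h
      (hasDerivWithinAt_of_mem_steep hy)).trans
    (hf.strictConcaveOn.slope_lt_of_hasDerivWithinAt hx.1 hy.1 h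
      (hasDerivWithinAt_of_mem_steep hx))

theorem exists_tendsto_deriv_of_bddAbove (hf : IsUtility f) (hb : BddAbove (deriv f '' Ioi 0)) :
    ∃ L, Tendsto (deriv f) (𝓝[>] 0) (𝓝 L) ∧ HasDerivWithinAt f L (Ici 0) 0 := by
  have hL := hf.strictAntiOn_deriv.antitoneOn.tendsto_nhdsGT hb
  exact ⟨_, hL, hasDerivWithinAt_Ici_of_tendsto_deriv (s := Ioi 0)
    (fun x hx => (hf.differentiableAt hx).differentiableWithinAt)
    ((hf.continuousOn 0 (mem_Ici.2 le_rfl)).mono Ioi_subset_Ici_self) self_mem_nhdsWithin hL⟩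

theorem bddAbove_deriv (hf : IsUtility f) (h0 : 0 ∈ steep f) : BddAbove (deriv f '' Ioi 0) := by
  refine ⟨marginal f 0, ?_⟩
  rintro _ ⟨x, hx, rfl⟩
  rw [← marginal_eq_deriv (f := f) hx]
  exact (hf.strictAntiOn_marginal h0 (hf.mem_steep_of_pos hx) hx).le

theorem tendsto_deriv_nhdsGT (hf : IsUtility f) (h0 : 0 ∈ steep f) :
    Tendsto (deriv f) (𝓝[>] 0) (𝓝 (marginal f 0)) := by
  obtain ⟨L, hL, hd⟩ := hf.exists_tendsto_deriv_of_bddAbove (hf.bddAbove_deriv h0)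
  rwa [marginal, hd.derivWithin (uniqueDiffOn_Ici 0 0 (mem_Ici.2 le_rfl))]

/-- If `f'` were bounded near `0`, its limit there would be the right derivative at `0`, and it
would be at least `f'(1) > 0`. So `0 ∉ steep f` is exactly the case of infinite slope. -/
theorem not_bddAbove_deriv (hf : IsUtility f) (h0 : 0 ∉ steep f) :
    ¬ BddAbove (deriv f '' Ioi 0) := by
  intro hb
  obtain ⟨L, hL, hd⟩ := hf.exists_tendsto_deriv_of_bddAbove hb
  refine h0 ⟨le_rfl, ?_⟩
  rw [marginal, hd.derivWithin (uniqueDiffOn_Ici 0 0 (mem_Ici.2 le_rfl))]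
  refine (hf.deriv_pos 1 one_pos).trans_le (ge_of_tendsto hL ?_)
  filter_upwards [Ioo_mem_nhdsGT (zero_lt_one' ℝ)] with x hx
  exact (hf.strictAntiOn_deriv hx.1 (mem_Ioi.2 one_pos) hx.2).le

theorem slopeAtZero_eq (hf : IsUtility f) (h0 : 0 ∈ steep f) :
    slopeAtZero f = (marginal f 0 : ℝ) :=
  ((continuous_coe_real_ereal.tendsto _).comp (hf.tendsto_deriv_nhdsGT h0)).limUnder_eq

theorem continuousOn_marginal (hf : IsUtility f) : ContinuousOn (marginal f) (steep f) := by
  intro x hx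
  rcases hx.1.eq_or_lt with rfl | h
  · have h1 : Tendsto (marginal f) (𝓝[>] 0) (𝓝 (marginal f 0)) := by
      refine (hf.tendsto_deriv_nhdsGT hx).congr' ?_
      filter_upwards [self_mem_nhdsWithin] with x hx using (marginal_eq_deriv hx).symm
    have h2 : ContinuousWithinAt (marginal f) (Ici 0) 0 := by
      rw [← continuousWithinAt_Ioi_iff_Ici]; exact h1
    exact h2.mono fun y hy => hy.1
  · have h1 : ContinuousAt (deriv f) x := (hf.hasDerivAt_deriv h).continuousAt
    refine (h1.congr ?_).continuousWithinAt
    filter_upwards [Ioi_mem_nhds h] with y hy using (marginal_eq_deriv hy).symm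

theorem tendsto_marginal (hf : IsUtility f) : Tendsto (marginal f) atTop (𝓝 0) := by
  refine hf.tendsto_deriv.congr' ?_
  filter_upwards [eventually_gt_atTop 0] with x hx using (marginal_eq_deriv hx).symm

theorem exists_marginal_eq (hf : IsUtility f) {x p : ℝ} (hx : x ∈ steep f) (hp : 0 < p)
    (hpx : p ≤ marginal f x) : ∃ y, x ≤ y ∧ marginal f y = p := by
  obtain ⟨z, hz, hxz⟩ :=
    ((hf.tendsto_marginal.eventually_lt_const hp).and (eventually_ge_atTop x)).exists
  obtain ⟨y, hy, rfl⟩ := intermediate_value_Icc' hxz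
    (hf.continuousOn_marginal.mono fun y hy => hf.mem_steep_of_le hx hy.1) ⟨hz.le, hpx⟩
  exact ⟨y, hy.1, rfl⟩

theorem marginal_marginalInv (hf : IsUtility f) {x p : ℝ} (hx : x ∈ steep f) (hp : 0 < p)
    (hpx : p ≤ marginal f x) : marginal f (marginalInv f p) = p := by
  obtain ⟨y, hy, h⟩ := hf.exists_marginal_eq hx hp hpx
  exact Function.invFunOn_eq ⟨y, hx.1.trans hy, h⟩

theorem marginalInv_mem_steep (hf : IsUtility f) {x p : ℝ} (hx : x ∈ steep f) (hp : 0 < p)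
    (hpx : p ≤ marginal f x) : marginalInv f p ∈ steep f := by
  obtain ⟨y, hy, h⟩ := hf.exists_marginal_eq hx hp hpx
  exact ⟨Function.invFunOn_mem (f := marginal f) (s := Ici 0) ⟨y, hx.1.trans hy, h⟩,
    (hf.marginal_marginalInv hx hp hpx).symm ▸ hp⟩

theorem marginalInv_marginal (hf : IsUtility f) {x : ℝ} (hx : x ∈ steep f) :
    marginalInv f (marginal f x) = x :=
  hf.strictAntiOn_marginal.injOn (hf.marginalInv_mem_steep hx hx.2 le_rfl) hx
    (hf.marginal_marginalInv hx hx.2 le_rfl)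

theorem strictAntiOn_marginalInv (hf : IsUtility f) {x : ℝ} (hx : x ∈ steep f) :
    StrictAntiOn (marginalInv f) (Ioc 0 (marginal f x)) := by
  intro p hp q hq h
  rw [← hf.strictAntiOn_marginal.lt_iff_gt (hf.marginalInv_mem_steep hx hp.1 hp.2)
    (hf.marginalInv_mem_steep hx hq.1 hq.2)]
  rwa [hf.marginal_marginalInv hx hp.1 hp.2, hf.marginal_marginalInv hx hq.1 hq.2]

theorem lt_marginalInv (hf : IsUtility f) {x y p : ℝ} (hx : x ∈ steep f) (hp : 0 < p)
    (hpx : p ≤ marginal f x) (hy : y ∈ steep f) (h : p < marginal f y) : y < marginalInv f p := by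
  rw [← hf.strictAntiOn_marginal.lt_iff_gt (hf.marginalInv_mem_steep hx hp hpx) hy]
  rwa [hf.marginal_marginalInv hx hp hpx]

theorem marginalInv_lt (hf : IsUtility f) {x y p : ℝ} (hx : x ∈ steep f) (hp : 0 < p)
    (hpx : p ≤ marginal f x) (hy : y ∈ steep f) (h : marginal f y < p) : marginalInv f p < y := by
  rw [← hf.strictAntiOn_marginal.lt_iff_gt hy (hf.marginalInv_mem_steep hx hp hpx)]
  rwa [hf.marginal_marginalInv hx hp hpx]

theorem continuousOn_marginalInv (hf : IsUtility f) {x : ℝ} (hx : x ∈ steep f) :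
    ContinuousOn (marginalInv f) (Ioc 0 (marginal f x)) := by
  intro p hp
  have hs := hf.marginalInv_mem_steep hx hp.1 hp.2
  have hm := hf.marginal_marginalInv hx hp.1 hp.2
  refine tendsto_order.2 ⟨fun a ha => ?_, fun b hb => ?_⟩
  · by_cases h : a ∈ steep f
    · have hlt : p < marginal f a := by
        conv_lhs => rw [← hm]
        exact hf.strictAntiOn_marginal h hs ha
      filter_upwards [self_mem_nhdsWithin, nhdsWithin_le_nhds (Iio_mem_nhds hlt)] with q hq hqa
      exact hf.lt_marginalInv hx hq.1 hq.2 h hqa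
    · filter_upwards [self_mem_nhdsWithin] with q hq
      by_contra! hc
      exact h (hf.mem_steep_of_le (hf.marginalInv_mem_steep hx hq.1 hq.2) hc)
  · have h := hf.mem_steep_of_le hs hb.le
    have hlt : marginal f b < p := by
      conv_rhs => rw [← hm]
      exact hf.strictAntiOn_marginal hs h hb
    filter_upwards [self_mem_nhdsWithin, nhdsWithin_le_nhds (Ioi_mem_nhds hlt)] with q hq hqb
    exact hf.marginalInv_lt hx hq.1 hq.2 h hqb

/-- The strict bound on `p` forces `(f')⁻¹(p) > 0`, where `f''` exists and is negative, so the
inverse function rule applies. -/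
theorem hasDerivAt_marginalInv (hf : IsUtility f) {x p : ℝ} (hx : x ∈ steep f) (hp : 0 < p)
    (hpx : p < marginal f x) : ∃ d < 0, HasDerivAt (marginalInv f) d p := by
  have hpos : 0 < marginalInv f p := hx.1.trans_lt (hf.lt_marginalInv hx hp hpx.le hx hpx)
  have hmem : Ioc 0 (marginal f x) ∈ 𝓝 p := mem_of_superset (Ioo_mem_nhds hp hpx) Ioo_subset_Ioc_self
  have hc : ContinuousAt (marginalInv f) p := (hf.continuousOn_marginalInv hx).continuousAt hmem
  refine ⟨_, inv_lt_zero.2 (hf.deriv_deriv_neg _ hpos), HasDerivAt.of_local_left_inverse hc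
    (hf.hasDerivAt_deriv hpos) (hf.deriv_deriv_neg _ hpos).ne ?_⟩
  filter_upwards [hmem, hc.tendsto.eventually_const_lt hpos] with q hq hq'
  rw [← marginal_eq_deriv (f := f) hq', hf.marginal_marginalInv hx hq.1 hq.2]

/-- The envelope theorem for `p ↦ f (x(p)) - p (α + x(p))`, where `x = (f')⁻¹`. -/
theorem hasDerivWithinAt_legendre (hf : IsUtility f) (α : ℝ) {x p : ℝ} (hx : x ∈ steep f)
    (hp : p ∈ Ioc 0 (marginal f x)) :
    HasDerivWithinAt (fun q => f (marginalInv f q) - q * (α + marginalInv f q))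
      (-(α + marginalInv f p)) (Ioc 0 (marginal f x)) p := by
  set g : ℝ → ℝ := fun q => f (marginalInv f q) - q * (α + marginalInv f q) with hg
  -- The subgradient inequality of the convex function `g`. Used at both points, it traps the
  -- first-order remainder between `0` and `(q - p)` times the increment of `-(f')⁻¹`, so continuity
  -- of the inverse suffices, also at the endpoint.
  have key : ∀ q ∈ Ioc 0 (marginal f x), ∀ s ∈ Ioc 0 (marginal f x),
      -(s - q) * (α + marginalInv f q) ≤ g s - g q := by
    intro q hq s hs
    have := hf.le_tangent (hf.marginalInv_mem_steep hx hs.1 hs.2)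
      (hf.marginalInv_mem_steep hx hq.1 hq.2).1
    rw [hf.marginal_marginalInv hx hs.1 hs.2] at this
    simp only [hg]
    linarith
  rw [hasDerivWithinAt_iff_isLittleO, Asymptotics.isLittleO_iff]
  intro c hc
  filter_upwards [self_mem_nhdsWithin,
    (hf.continuousOn_marginalInv hx p hp).eventually (Metric.ball_mem_nhds _ hc)] with q hq hq'
  have h1 := key p hp q hq
  have h2 := key q hq p hp
  rw [Real.dist_eq] at hq'
  rw [Real.norm_eq_abs, Real.norm_eq_abs, smul_eq_mul]
  have h3 : g q - g p - (q - p) * -(α + marginalInv f p)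
      ≤ (q - p) * -(marginalInv f q - marginalInv f p) := by linarith
  have h4 : 0 ≤ g q - g p - (q - p) * -(α + marginalInv f p) := by linarith
  rw [abs_of_nonneg h4]
  refine h3.trans ((le_abs_self _).trans ?_)
  rw [abs_mul, abs_neg, mul_comm]
  gcongr

end IsUtility

/-! ### The tangency point `c₀`. -/

namespace HabitModel

open IsUtility

variable {M : HabitModel}

/-- By the tangent inequality, `F(x) = (α + x) U₊'(x) - U₊(x)` is strictly decreasing; it is at most
`α U₊'(x)`, which tends to `0`, and the slope hypothesis makes it reach `U₋(α)` near the origin.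
Hence the tangency set is a singleton. -/
theorem exists_tangency (hα : 0 < M.α) (hUp : IsUtility M.Up) (hUm : IsUtility M.Um)
    (hLA : ((M.Um M.α : ℝ) : EReal) ≤ ((M.α : ℝ) : EReal) * slopeAtZero M.Up) :
    ∃ x ∈ steep M.Up, M.c₀ = M.α + x ∧ (M.α + x) * marginal M.Up x - M.Up x = M.Um M.α := by
  set F : ℝ → ℝ := fun x => (M.α + x) * marginal M.Up x - M.Up x with hF
  have hcont : ContinuousOn F (steep M.Up) :=
    ((continuousOn_const.add continuousOn_id).mul hUp.continuousOn_marginal).sub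
      (hUp.continuousOn.mono fun x hx => hx.1)
  have hanti : StrictAntiOn F (steep M.Up) := by
    intro x hx y hy h
    have h1 := hUp.le_tangent hy hx.1
    have h2 := hUp.strictAntiOn_marginal hx hy h
    have h3 := mul_le_mul_of_nonneg_left h2.le hx.1
    have h4 := mul_lt_mul_of_pos_left h2 hα
    simp only [hF]
    linarith
  have hUmpos := hUm.pos hα
  have hlow : ∃ a ∈ steep M.Up, M.Um M.α ≤ F a := by
    by_cases h0 : (0 : ℝ) ∈ steep M.Up
    · refine ⟨0, h0, ?_⟩
      rw [hUp.slopeAtZero_eq h0, ← EReal.coe_mul, EReal.coe_le_coe_iff] at hLA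
      simpa [hF, hUp.map_zero] using hLA
    · have hb := hUp.not_bddAbove_deriv h0
      rw [not_bddAbove_iff] at hb
      obtain ⟨_, ⟨x, hx, rfl⟩, hgt⟩ :=
        -- The second bound forces `x < 1`, hence `U₊(x) < U₊(1)`; the first then gives `α U₊'(x) -
        -- U₊(x) > U₋(α)`.
        hb (max ((M.Um M.α + M.Up 1) / M.α) (deriv M.Up 1))
      rw [max_lt_iff, div_lt_iff₀ hα] at hgt
      have hx1 : x < 1 := (hUp.strictAntiOn_deriv.lt_iff_gt (mem_Ioi.2 one_pos) hx).1 hgt.2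
      refine ⟨x, hUp.mem_steep_of_pos hx, ?_⟩
      have h1 := hUp.strictMonoOn (mem_Ici.2 (le_of_lt hx)) (mem_Ici.2 zero_le_one) hx1
      have h2 := mul_pos (mem_Ioi.1 hx) (hUp.deriv_pos x hx)
      simp only [hF, marginal_eq_deriv (f := M.Up) hx]
      nlinarith
  obtain ⟨a, ha, hFa⟩ := hlow
  obtain ⟨b, hb, hab⟩ := ((hUp.tendsto_marginal.eventually_lt_const
    (div_pos hUmpos hα)).and (eventually_ge_atTop a)).exists
  rw [lt_div_iff₀ hα] at hb
  have hbs := hUp.mem_steep_of_le ha hab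
  have hFb : F b ≤ M.Um M.α := by
    have := hUp.le_tangent hbs le_rfl
    rw [hUp.map_zero] at this
    simp only [hF]
    linarith
  obtain ⟨x, hx, hFx⟩ := intermediate_value_Icc' hab
    (hcont.mono fun y hy => hUp.mem_steep_of_le ha hy.1) ⟨hFb, hFa⟩
  have hxs := hUp.mem_steep_of_le ha hx.1
  refine ⟨x, hxs, ?_, hFx⟩
  have hset : M.tangencySet = {M.α + x} := by
    ext c
    simp only [tangencySet, mem_ofPred_eq, mem_singleton_iff]
    constructor
    · rintro ⟨hc, h⟩
      -- At `c = α` the equation reads `α U₊'(0) = U₋(α) > 0`, which excludes the default value `0`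
      -- taken by `marginal` when the slope is infinite.
      have hcs : c - M.α ∈ steep M.Up := by
        rcases hc.eq_or_lt with rfl | hc
        · refine ⟨by simp, ?_⟩
          rw [sub_self, hUp.map_zero, sub_zero] at h
          rw [sub_self]
          exact pos_of_mul_pos_right (h ▸ hUmpos) hα.le
        · exact hUp.mem_steep_of_pos (sub_pos.2 hc)
      have : F (c - M.α) = F x := by
        rw [hFx, ← h]; simp [hF]
      linarith [hanti.injOn hcs hxs this]
    · rintro rfl
      refine ⟨by linarith [hxs.1], ?_⟩
      simpa [hF] using hFx
  rw [c₀, hset, csInf_singleton]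

end HabitModel
end

noncomputable section

/-! ### From a solution of the system to the dual problem. -/

namespace HabitModel

open IsUtility

variable {M : HabitModel}

/-- The point `c₀ - α`, where the tangent from the loss side touches the gain utility. -/
theorem exists_φ₀_eq (hα : 0 < M.α) (hUp : IsUtility M.Up) (hUm : IsUtility M.Um)
    (hLA : ((M.Um M.α : ℝ) : EReal) ≤ ((M.α : ℝ) : EReal) * slopeAtZero M.Up) :
    ∃ x ∈ steep M.Up, M.φ₀ = marginal M.Up x ∧ M.G M.φ₀ = M.U 0 := by
  obtain ⟨x, hx, hc, h⟩ := exists_tangency hα hUp hUm hLA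
  have hφ : M.φ₀ = marginal M.Up x := by rw [φ₀, hc, add_sub_cancel_left]
  refine ⟨x, hx, hφ, ?_⟩
  rw [G, hφ, hUp.marginalInv_marginal hx, U, if_neg hα.not_gt, sub_zero]
  linarith

namespace IsSystemSolution

variable {y₀ : ℝ} {φ ψ : ℝ → ℝ}

theorem y₀_pos (h : M.IsSystemSolution y₀ φ ψ) (hφ₀ : 0 < M.φ₀) (hlam : M.lam < 0) : 0 < y₀ := by
  refine lt_of_le_of_lt ?_ h.mem_y₀.1
  exact div_nonneg_of_nonpos (mul_nonpos_of_nonneg_of_nonpos hφ₀.le hlam.le) (by linarith)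

/-- This form isolates the factor `1 / y`, hence the logarithmic-time derivative `y ψ'`. -/
theorem hasDerivWithinAt_ψ (h : M.IsSystemSolution y₀ φ ψ) (hμ : 0 < M.μ) (hσ : 0 < M.σ)
    (hρ : 0 < M.ρ) {y : ℝ} (hy : y ∈ Ioc 0 y₀) :
    HasDerivWithinAt ψ
      (1 / y * (2 * M.σ ^ 2 / M.μ ^ 2) * ((1 - ψ y) * (M.ρ * marginalInv M.Up (φ y)
        - M.μ ^ 2 / (2 * M.σ ^ 2) * ψ y - (M.r - M.δ + M.ρ - M.ρ * M.α))
        + (M.r + M.ρ) * y / φ y - M.δ)) (Ioc 0 y₀) y := by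
  convert h.ode_ψ y hy using 1
  have := (h.mem_φ y hy).1.ne'
  have := hy.1.ne'
  field_simp
  ring

/-- The equation for `ψ` is the derivative of the second-order equation for `u`: after the envelope
formula for `G`, the terms in `ψ` and `(U₊')⁻¹` cancel. -/
theorem hasDerivWithinAt_dualFun (h : M.IsSystemSolution y₀ φ ψ) (hμ : 0 < M.μ) (hσ : 0 < M.σ)
    (hρ : 0 < M.ρ) (hδ : 0 < M.δ) (hUp : IsUtility M.Up) {x : ℝ} (hx : x ∈ steep M.Up)
    (hφ₀ : M.φ₀ = marginal M.Up x) {y : ℝ} (hy : y ∈ Ioc 0 y₀) :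
    HasDerivWithinAt (M.dualFun φ ψ) ((y - φ y) / (M.ρ * y)) (Ioc 0 y₀) y := by
  have hφpos := (h.mem_φ y hy).1.ne'
  have hG : HasDerivWithinAt (fun y => M.G (φ y)) _ (Ioc 0 y₀) y :=
    HasDerivWithinAt.comp y (h₂ := M.G) (s' := Ioc 0 M.φ₀) (by
      rw [hφ₀]; exact hUp.hasDerivWithinAt_legendre M.α hx (hφ₀ ▸ h.mem_φ y hy))
      (h.ode_φ y hy) h.mem_φ
  have hd : HasDerivWithinAt (M.dualFun φ ψ) _ (Ioc 0 y₀) y :=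
    ((((h.ode_φ y hy).const_mul (M.μ ^ 2 / (2 * M.ρ * M.σ ^ 2))).mul
    (h.hasDerivWithinAt_ψ hμ hσ hρ hy)).add hG).add
    (((hasDerivWithinAt_id y (Ioc 0 y₀)).sub (h.ode_φ y hy)).const_mul
      ((M.δ - M.r - M.ρ) / M.ρ)) |>.const_mul (1 / M.δ)
  refine hd.congr_deriv ?_
  have := hy.1.ne'
  field_simp
  ring

/-- Since `ρ u' = 1 - φ / y`, this carries `u''`: its sign is governed by `ψ > 0`. -/
theorem hasDerivWithinAt_div (h : M.IsSystemSolution y₀ φ ψ) {y : ℝ} (hy : y ∈ Ioc 0 y₀) :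
    HasDerivWithinAt (fun y => φ y / y) (-(φ y * ψ y / y ^ 2)) (Ioc 0 y₀) y := by
  have := hy.1.ne'
  refine ((h.ode_φ y hy).div (hasDerivWithinAt_id y _) this).congr_deriv ?_
  simp only [id]
  field_simp
  ring

theorem hasDerivWithinAt_slope (h : M.IsSystemSolution y₀ φ ψ) (hρ : 0 < M.ρ) {y : ℝ}
    (hy : y ∈ Ioc 0 y₀) :
    HasDerivWithinAt (fun y => (y - φ y) / (M.ρ * y)) (1 / (M.ρ * y ^ 2) * φ y * ψ y)
      (Ioc 0 y₀) y := by
  have hd := ((h.hasDerivWithinAt_div hy).const_sub 1).const_mul (1 / M.ρ)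
  refine (hd.congr_deriv ?_).congr_of_mem (fun z hz => ?_) hy
  · have := hy.1.ne'
    field_simp
  · have := hz.1.ne'
    field_simp

theorem continuousOn_φ (h : M.IsSystemSolution y₀ φ ψ) : ContinuousOn φ (Ioc 0 y₀) :=
  fun y hy => (h.ode_φ y hy).continuousWithinAt

theorem continuousOn_ψ (h : M.IsSystemSolution y₀ φ ψ) : ContinuousOn ψ (Ioc 0 y₀) :=
  fun y hy => (h.ode_ψ y hy).continuousWithinAt

/-- The quotient `φ / y` decreases to its final value `φ₀ / y₀ > 1`. This is what makes `u' < 0`. -/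
theorem lt_φ (h : M.IsSystemSolution y₀ φ ψ) {y : ℝ} (hy : y ∈ Ioc 0 y₀) : y < φ y := by
  have hy₀ : 0 < y₀ := hy.1.trans_le hy.2
  have hanti : AntitoneOn (fun y => φ y / y) (Ioc 0 y₀) := by
    refine antitoneOn_of_deriv_nonpos (convex_Ioc 0 y₀)
      (fun y hy => (h.hasDerivWithinAt_div hy).continuousWithinAt)
      (fun y hy => ?_) (fun y hy => ?_) <;> rw [interior_Ioc] at hy <;>
      have hd := (h.hasDerivWithinAt_div (Ioo_subset_Ioc_self hy)).hasDerivAt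
        (Ioc_mem_nhds hy.1 hy.2)
    · exact hd.differentiableAt.differentiableWithinAt
    · rw [hd.deriv, neg_nonpos]
      have h1 := (h.mem_φ y (Ioo_subset_Ioc_self hy)).1
      have h2 := (h.mem_ψ y (Ioo_subset_Ioc_self hy)).1
      positivity
  have := hanti hy ⟨hy₀, le_rfl⟩ hy.2
  have h1 : 1 < φ y₀ / y₀ := by
    rw [one_lt_div hy₀, h.boundary_φ]; exact h.mem_y₀.2
  exact (one_lt_div hy.1).1 (h1.trans_le this)

theorem isReducedDualSolution (h : M.IsSystemSolution y₀ φ ψ) (hμ : 0 < M.μ) (hσ : 0 < M.σ)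
    (hρ : 0 < M.ρ) (hδ : 0 < M.δ) (hlam : M.lam < 0) (hUp : IsUtility M.Up) {x : ℝ}
    (hx : x ∈ steep M.Up) (hφ₀ : M.φ₀ = marginal M.Up x) (hG : M.G M.φ₀ = M.U 0) :
    M.IsReducedDualSolution (M.dualFun φ ψ) y₀ := by
  have hy₀ : 0 < y₀ := h.y₀_pos (hφ₀ ▸ hx.2) hlam
  have hmem : y₀ ∈ Ioc 0 y₀ := ⟨hy₀, le_rfl⟩
  have hu := uniqueDiffOn_Ioc (0 : ℝ) y₀
  have hd : ∀ y ∈ Ioc 0 y₀, HasDerivWithinAt (M.dualFun φ ψ) _ (Ioc 0 y₀) y :=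
    fun y hy => h.hasDerivWithinAt_dualFun hμ hσ hρ hδ hUp hx hφ₀ hy
  have h1 : ∀ y ∈ Ioc 0 y₀, derivWithin (M.dualFun φ ψ) (Ioc 0 y₀) y = (y - φ y) / (M.ρ * y) :=
    fun y hy => (hd y hy).derivWithin (hu y hy)
  have hd2 : ∀ y ∈ Ioc 0 y₀, HasDerivWithinAt (derivWithin (M.dualFun φ ψ) (Ioc 0 y₀))
      (1 / (M.ρ * y ^ 2) * φ y * ψ y) (Ioc 0 y₀) y :=
    fun y hy => (h.hasDerivWithinAt_slope hρ hy).congr_of_mem h1 hy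
  have h2 : ∀ y ∈ Ioc 0 y₀, derivWithin (derivWithin (M.dualFun φ ψ) (Ioc 0 y₀)) (Ioc 0 y₀) y
      = 1 / (M.ρ * y ^ 2) * φ y * ψ y :=
    fun y hy => (hd2 y hy).derivWithin (hu y hy)
  have hphi : ∀ y ∈ Ioc 0 y₀,
      y - M.ρ * y * derivWithin (M.dualFun φ ψ) (Ioc 0 y₀) y = φ y := by
    intro y hy
    have := hy.1.ne'
    rw [h1 y hy]
    field_simp
    ring
  refine ⟨hy₀, ?_, fun y hy => hphi y hy ▸ h.mem_φ y hy, fun y hy => ?_, ?_, ?_⟩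
  · have hc2 : ContDiffOn ℝ 0 (derivWithin (derivWithin (M.dualFun φ ψ) (Ioc 0 y₀)) (Ioc 0 y₀))
        (Ioc 0 y₀) := by
      rw [contDiffOn_zero]
      refine ContinuousOn.congr (((continuousOn_const.div (by fun_prop) fun y hy => ?_).mul
        h.continuousOn_φ).mul h.continuousOn_ψ) h2
      have := hy.1
      positivity
    have hc1 : ContDiffOn ℝ 1 (derivWithin (M.dualFun φ ψ) (Ioc 0 y₀)) (Ioc 0 y₀) := by
      rw [← zero_add 1, contDiffOn_succ_iff_derivWithin hu]
      exact ⟨fun y hy => (hd2 y hy).differentiableWithinAt, by simp, hc2⟩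
    rw [← one_add_one_eq_two, contDiffOn_succ_iff_derivWithin hu]
    exact ⟨fun y hy => (hd y hy).differentiableWithinAt, by simp, hc1⟩
  · have := hy.1.ne'
    rw [hphi y hy, h1 y hy, h2 y hy, dualFun]
    field_simp
    ring
  · rw [hphi y₀ hmem, h.boundary_φ]
  -- The boundary value of `ψ` is the one for which the terms in `r + ρ - δ` cancel, leaving `(y₀ -
  -- φ₀) / (ρ λ)` and `G(φ₀) / δ = U(0) / δ`.
  · have hφpos : 0 < M.φ₀ := hφ₀ ▸ hx.2
    have := hlam.ne
    rw [dualFun, h.boundary_ψ, h.boundary_φ, hG]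
    field_simp
    ring

theorem hasDerivAt_dualFun (h : M.IsSystemSolution y₀ φ ψ) (hμ : 0 < M.μ) (hσ : 0 < M.σ)
    (hρ : 0 < M.ρ) (hδ : 0 < M.δ) (hUp : IsUtility M.Up) {x : ℝ} (hx : x ∈ steep M.Up)
    (hφ₀ : M.φ₀ = marginal M.Up x) {y : ℝ} (hy : y ∈ Ioo 0 y₀) :
    HasDerivAt (M.dualFun φ ψ) ((y - φ y) / (M.ρ * y)) y :=
  (h.hasDerivWithinAt_dualFun hμ hσ hρ hδ hUp hx hφ₀ (Ioo_subset_Ioc_self hy)).hasDerivAt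
    (Ioc_mem_nhds hy.1 hy.2)

theorem hasDerivAt_deriv_dualFun (h : M.IsSystemSolution y₀ φ ψ) (hμ : 0 < M.μ) (hσ : 0 < M.σ)
    (hρ : 0 < M.ρ) (hδ : 0 < M.δ) (hUp : IsUtility M.Up) {x : ℝ} (hx : x ∈ steep M.Up)
    (hφ₀ : M.φ₀ = marginal M.Up x) {y : ℝ} (hy : y ∈ Ioo 0 y₀) :
    HasDerivAt (deriv (M.dualFun φ ψ)) (1 / (M.ρ * y ^ 2) * φ y * ψ y) y := by
  refine ((h.hasDerivWithinAt_slope hρ (Ioo_subset_Ioc_self hy)).hasDerivAt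
    (Ioc_mem_nhds hy.1 hy.2)).congr_of_eventuallyEq ?_
  filter_upwards [Ioo_mem_nhds hy.1 hy.2] with z hz
  exact (h.hasDerivAt_dualFun hμ hσ hρ hδ hUp hx hφ₀ hz).deriv

theorem strictAntiOn_dualFun (h : M.IsSystemSolution y₀ φ ψ) (hμ : 0 < M.μ) (hσ : 0 < M.σ)
    (hρ : 0 < M.ρ) (hδ : 0 < M.δ) (hUp : IsUtility M.Up) {x : ℝ} (hx : x ∈ steep M.Up)
    (hφ₀ : M.φ₀ = marginal M.Up x) : StrictAntiOn (M.dualFun φ ψ) (Ioo 0 y₀) := by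
  have hd : ∀ y ∈ Ioo 0 y₀, HasDerivAt (M.dualFun φ ψ) _ y :=
    fun y hy => h.hasDerivAt_dualFun hμ hσ hρ hδ hUp hx hφ₀ hy
  refine strictAntiOn_of_deriv_neg (convex_Ioo 0 y₀)
    (fun y hy => (hd y hy).continuousAt.continuousWithinAt) fun y hy => ?_
  rw [interior_Ioo] at hy
  rw [(hd y hy).deriv]
  exact div_neg_of_neg_of_pos (sub_neg.2 (h.lt_φ (Ioo_subset_Ioc_self hy))) (mul_pos hρ hy.1)

theorem strictConvexOn_dualFun (h : M.IsSystemSolution y₀ φ ψ) (hμ : 0 < M.μ) (hσ : 0 < M.σ)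
    (hρ : 0 < M.ρ) (hδ : 0 < M.δ) (hUp : IsUtility M.Up) {x : ℝ} (hx : x ∈ steep M.Up)
    (hφ₀ : M.φ₀ = marginal M.Up x) : StrictConvexOn ℝ (Ioo 0 y₀) (M.dualFun φ ψ) := by
  have hd : ∀ y ∈ Ioo 0 y₀, HasDerivAt (M.dualFun φ ψ) _ y :=
    fun y hy => h.hasDerivAt_dualFun hμ hσ hρ hδ hUp hx hφ₀ hy
  have hd2 : ∀ y ∈ Ioo 0 y₀, HasDerivAt (deriv (M.dualFun φ ψ)) _ y :=
    fun y hy => h.hasDerivAt_deriv_dualFun hμ hσ hρ hδ hUp hx hφ₀ hy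
  refine StrictMonoOn.strictConvexOn_of_deriv (convex_Ioo 0 y₀)
    (fun y hy => (hd y hy).continuousAt.continuousWithinAt) ?_
  rw [interior_Ioo]
  refine strictMonoOn_of_deriv_pos (convex_Ioo 0 y₀)
    (fun y hy => (hd2 y hy).continuousAt.continuousWithinAt) fun y hy => ?_
  rw [interior_Ioo] at hy
  rw [(hd2 y hy).deriv]
  have h1 := (h.mem_φ y (Ioo_subset_Ioc_self hy)).1
  have h2 := (h.mem_ψ y (Ioo_subset_Ioc_self hy)).1
  have h3 := hy.1
  positivity

theorem exists_tendsto_φ (h : M.IsSystemSolution y₀ φ ψ) (hy₀ : 0 < y₀) :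
    ∃ φ0, 0 ≤ φ0 ∧ Tendsto φ (𝓝[>] 0) (𝓝 φ0) := by
  have hmem : ∀ y ∈ Ioo 0 y₀, 0 ≤ φ y := fun y hy => (h.mem_φ y (Ioo_subset_Ioc_self hy)).1.le
  refine ⟨_, ?_, (h.mono_φ.monotoneOn.mono Ioo_subset_Ioc_self).tendsto_nhdsWithin_Ioo_right
    (nonempty_Ioo.2 hy₀) ⟨0, ?_⟩⟩
  · exact Real.sInf_nonneg (by rintro _ ⟨y, hy, rfl⟩; exact hmem y hy)
  · rintro _ ⟨y, hy, rfl⟩; exact hmem y hy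

/-- In logarithmic time, `ψ` can not stay away from `1` while `(U₊')⁻¹(φ)` is large. -/
theorem lt_ψ_of_le_marginalInv (h : M.IsSystemSolution y₀ φ ψ) (hr : 0 ≤ M.r) (hμ : 0 < M.μ)
    (hσ : 0 < M.σ) (hρ : 0 < M.ρ) (hδ : 0 < M.δ) {ε y : ℝ} (hε : 0 < ε) (hy : y ∈ Ioc 0 y₀)
    (hlarge : ∀ z ∈ Ioc 0 y, M.μ ^ 2 / (2 * M.σ ^ 2) + (M.r - M.δ + M.ρ - M.ρ * M.α)
      + (M.δ + M.μ ^ 2 / (2 * M.σ ^ 2)) / ε ≤ M.ρ * marginalInv M.Up (φ z)) :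
    1 - ε < ψ y := by
  by_contra! hle
  set κ := M.μ ^ 2 / (2 * M.σ ^ 2) with hκ
  have hκpos : 0 < κ := by positivity
  have hκinv : 2 * M.σ ^ 2 / M.μ ^ 2 = κ⁻¹ := by rw [hκ, inv_div]
  have hmaps : MapsTo (fun t => y * Real.exp (-t)) (Ici 0) (Ioc 0 y) := fun t ht =>
    ⟨mul_pos hy.1 (Real.exp_pos _),
      mul_le_of_le_one_right hy.1.le (Real.exp_le_one_iff.2 (by simpa using ht))⟩
  have hsub : Ioc 0 y ⊆ Ioc 0 y₀ := Ioc_subset_Ioc_right hy.2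
  have hexp : ∀ t, HasDerivAt (fun t => y * Real.exp (-t)) (-(y * Real.exp (-t))) t := by
    intro t
    simpa using ((hasDerivAt_neg t).exp.const_mul y)
  have hd : ∀ t ∈ Ici (0 : ℝ), HasDerivWithinAt (fun t => ψ (y * Real.exp (-t))) _ (Ici 0) t :=
    fun t ht => HasDerivWithinAt.comp t
      ((h.hasDerivWithinAt_ψ hμ hσ hρ (hsub (hmaps ht))).mono hsub)
      (hexp t).hasDerivWithinAt hmaps
  -- Barrier of slope `-1/2`: at contact `1 - ψ ≥ ε`, and the assumed size of `(U₊')⁻¹(φ)` makes the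
  -- slope of `ψ` at most `-1`. At `t = 2` the barrier equals `-ε`, contradicting `ψ > 0`.
  have hB : ∀ t : ℝ, HasDerivAt (fun t => 1 - ε - t / 2) (-(1 / 2)) t :=
    fun t => ((hasDerivAt_id t).div_const 2).const_sub _
  have key := image_le_of_deriv_right_lt_deriv_boundary (a := 0) (b := 2)
    (fun t ht => (hd t ht.1).continuousWithinAt.mono fun s hs => hs.1)
    (fun t ht => (hd t ht.1).mono (Ici_subset_Ici.2 ht.1)) (by simpa using hle) hB
    (fun t ht heq => ?_)
  · have h1 := key (right_mem_Icc.2 zero_le_two)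
    have h2 := (h.mem_ψ _ (hsub (hmaps (mem_Ici.2 zero_le_two)))).1
    linarith
  · have hz := hmaps (mem_Ici.2 ht.1)
    simp only at heq hz ⊢
    set z := y * Real.exp (-t)
    have hzpos := hz.1
    have h1 := hlarge z hz
    have hψ := h.mem_ψ z (hsub hz)
    have hφ := (h.mem_φ z (hsub hz)).1
    have h2 : ε ≤ 1 - ψ z := by linarith [ht.1]
    have h3 : (M.δ + κ) / ε ≤ M.ρ * marginalInv M.Up (φ z) - κ * ψ z
        - (M.r - M.δ + M.ρ - M.ρ * M.α) := by
      have := mul_le_of_le_one_right hκpos.le hψ.2.le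
      linarith
    have h4 : M.δ + κ ≤ (1 - ψ z) * (M.ρ * marginalInv M.Up (φ z) - κ * ψ z
        - (M.r - M.δ + M.ρ - M.ρ * M.α)) := by
      calc M.δ + κ = ε * ((M.δ + κ) / ε) := by field_simp
        _ ≤ _ := mul_le_mul h2 h3 (by positivity) (hε.le.trans h2)
    have h5 : 0 ≤ (M.r + M.ρ) * z / φ z := by positivity
    rw [hκinv]
    have h6 : κ ≤ (1 - ψ z) * (M.ρ * marginalInv M.Up (φ z) - κ * ψ z
        - (M.r - M.δ + M.ρ - M.ρ * M.α)) + (M.r + M.ρ) * z / φ z - M.δ := by linarith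
    set A := (1 - ψ z) * (M.ρ * marginalInv M.Up (φ z) - κ * ψ z
        - (M.r - M.δ + M.ρ - M.ρ * M.α)) + (M.r + M.ρ) * z / φ z - M.δ
    have h7 : 1 / z * κ⁻¹ * A * -z = -(κ⁻¹ * A) := by field_simp
    have h8 : 1 ≤ κ⁻¹ * A := by
      rw [inv_mul_eq_div, one_le_div hκpos]; exact h6
    rw [h7]
    linarith

theorem tendsto_ψ_of_tendsto_zero (h : M.IsSystemSolution y₀ φ ψ) (hr : 0 ≤ M.r) (hμ : 0 < M.μ)
    (hσ : 0 < M.σ) (hρ : 0 < M.ρ) (hδ : 0 < M.δ) (hy₀ : 0 < y₀) (hUp : IsUtility M.Up) {x : ℝ}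
    (hx : x ∈ steep M.Up) (hφ₀ : M.φ₀ = marginal M.Up x) (hlim : Tendsto φ (𝓝[>] 0) (𝓝 0)) :
    Tendsto ψ (𝓝[>] 0) (𝓝 1) := by
  refine tendsto_order.2 ⟨fun a ha => ?_, fun b hb => ?_⟩
  · obtain ⟨N, hNx, hN⟩ : ∃ N, x ≤ N ∧ M.μ ^ 2 / (2 * M.σ ^ 2) + (M.r - M.δ + M.ρ - M.ρ * M.α)
      + (M.δ + M.μ ^ 2 / (2 * M.σ ^ 2)) / (1 - a) ≤ M.ρ * N := by
      simp_rw [← div_le_iff₀' hρ]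
      exact ⟨_, le_max_left _ _, le_max_right _ _⟩
    have hNs := hUp.mem_steep_of_le hx hNx
    obtain ⟨y₁, hy₁, hs⟩ := mem_nhdsGT_iff_exists_Ioo_subset.1
      ((hlim.eventually_lt_const hNs.2).and (Ioc_mem_nhdsGT hy₀))
    filter_upwards [Ioo_mem_nhdsGT hy₁] with y hy
    have hlt := h.lt_ψ_of_le_marginalInv hr hμ hσ hρ hδ (sub_pos.2 ha) (hs hy).2 fun z hz => ?_
    · linarith
    · have hz' := hs ⟨hz.1, hz.2.trans_lt hy.2⟩
      have hφ := h.mem_φ z hz'.2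
      have := hUp.lt_marginalInv hx hφ.1 (hφ₀ ▸ hφ.2) hNs hz'.1
      exact hN.trans (by gcongr)
  · filter_upwards [Ioc_mem_nhdsGT hy₀] with y hy
    exact (h.mem_ψ y hy).2.trans hb

theorem exists_limit (h : M.IsSystemSolution y₀ φ ψ) (hr : 0 ≤ M.r) (hμ : 0 < M.μ)
    (hσ : 0 < M.σ) (hρ : 0 < M.ρ) (hδ : 0 < M.δ) (hy₀ : 0 < y₀) (hUp : IsUtility M.Up) {x : ℝ}
    (hx : x ∈ steep M.Up) (hφ₀ : M.φ₀ = marginal M.Up x) :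
    ∃ φ0 : ℝ, Tendsto φ (𝓝[>] 0) (𝓝 φ0) ∧ (0 < φ0 ∨ Tendsto ψ (𝓝[>] 0) (𝓝 1)) := by
  obtain ⟨φ0, h0, hlim⟩ := h.exists_tendsto_φ hy₀
  refine ⟨φ0, hlim, ?_⟩
  rcases h0.eq_or_lt with rfl | h0
  · exact Or.inr (h.tendsto_ψ_of_tendsto_zero hr hμ hσ hρ hδ hy₀ hUp hx hφ₀ hlim)
  · exact Or.inl h0

/-- When `ψ → 1`, the logarithmic slope `y φ' / φ = 1 - ψ` is eventually below `1/2`, so `φ / √y` is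
antitone near `0` and `φ / y ≥ c / √y`. -/
theorem tendsto_div_atTop (h : M.IsSystemSolution y₀ φ ψ) (hy₀ : 0 < y₀) {φ0 : ℝ}
    (hlim : Tendsto φ (𝓝[>] 0) (𝓝 φ0)) (hor : 0 < φ0 ∨ Tendsto ψ (𝓝[>] 0) (𝓝 1)) :
    Tendsto (fun y => φ y / y) (𝓝[>] 0) atTop := by
  rcases hor with h0 | h1
  · exact hlim.pos_mul_atTop h0 tendsto_inv_nhdsGT_zero
  obtain ⟨y₁, hy₁, hs⟩ := mem_nhdsGT_iff_exists_Ioo_subset.1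
    ((h1.eventually_const_lt (show (1 / 2 : ℝ) < 1 by norm_num)).and (Ioo_mem_nhdsGT hy₀))
  have hy₁ : 0 < y₁ := hy₁
  have hd : ∀ y ∈ Ioo 0 y₁, HasDerivAt (fun y => φ y / √y)
      ((1 / y * φ y * (1 - ψ y) * √y - φ y * (1 / (2 * √y))) / √y ^ 2) y := fun y hy =>
    ((h.ode_φ y (Ioo_subset_Ioc_self (hs hy).2)).hasDerivAt
      (Ioc_mem_nhds hy.1 (hs hy).2.2)).div (Real.hasDerivAt_sqrt hy.1.ne')
      (Real.sqrt_pos.2 hy.1).ne'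
  have hanti : AntitoneOn (fun y => φ y / √y) (Ioo 0 y₁) := by
    refine antitoneOn_of_deriv_nonpos (convex_Ioo 0 y₁)
      (fun y hy => (hd y hy).continuousAt.continuousWithinAt) (fun y hy => ?_) fun y hy => ?_ <;>
      rw [interior_Ioo] at hy
    · exact (hd y hy).differentiableAt.differentiableWithinAt
    · rw [(hd y hy).deriv]
      have hypos := hy.1
      have hφ := (h.mem_φ y (Ioo_subset_Ioc_self (hs hy).2)).1
      have hψ : 1 / 2 < ψ y := (hs hy).1
      obtain ⟨s, hspos, rfl⟩ : ∃ s : ℝ, 0 < s ∧ y = s ^ 2 :=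
        ⟨√y, Real.sqrt_pos.2 hy.1, (Real.sq_sqrt hy.1.le).symm⟩
      rw [Real.sqrt_sq hspos.le]
      refine div_nonpos_of_nonpos_of_nonneg ?_ (by positivity)
      have : 1 / s ^ 2 * φ (s ^ 2) * (1 - ψ (s ^ 2)) * s - φ (s ^ 2) * (1 / (2 * s))
          = φ (s ^ 2) / s * (1 / 2 - ψ (s ^ 2)) := by field_simp; ring
      rw [this]
      exact mul_nonpos_of_nonneg_of_nonpos (by positivity) (by linarith)
  have hm : y₁ / 2 ∈ Ioo 0 y₁ := ⟨by linarith, by linarith⟩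
  set c := φ (y₁ / 2) / √(y₁ / 2) with hc
  have hcpos : 0 < c := div_pos (h.mem_φ _ (Ioo_subset_Ioc_self (hs hm).2)).1
    (Real.sqrt_pos.2 hm.1)
  have hsq : Tendsto (fun y => c * (√y)⁻¹) (𝓝[>] 0) atTop := by
    refine Tendsto.const_mul_atTop hcpos (tendsto_inv_nhdsGT_zero.comp ?_)
    refine tendsto_nhdsWithin_iff.2 ⟨?_, ?_⟩
    · simpa using (Real.continuous_sqrt.tendsto 0).mono_left nhdsWithin_le_nhds
    · filter_upwards [self_mem_nhdsWithin] with y hy using Real.sqrt_pos.2 hy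
  refine tendsto_atTop_mono' _ ?_ hsq
  filter_upwards [Ioo_mem_nhdsGT hm.1] with y hy
  have h2 := hanti ⟨hy.1, hy.2.trans hm.2⟩ hm hy.2.le
  have h3 := Real.sqrt_pos.2 hy.1
  calc c * (√y)⁻¹ ≤ φ y / √y * (√y)⁻¹ := by gcongr
    _ = φ y / y := by rw [← div_eq_mul_inv, div_div, Real.mul_self_sqrt hy.1.le]

theorem tendsto_deriv_dualFun (h : M.IsSystemSolution y₀ φ ψ) (hr : 0 ≤ M.r) (hμ : 0 < M.μ)
    (hσ : 0 < M.σ) (hρ : 0 < M.ρ) (hδ : 0 < M.δ) (hy₀ : 0 < y₀) (hUp : IsUtility M.Up) {x : ℝ}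
    (hx : x ∈ steep M.Up) (hφ₀ : M.φ₀ = marginal M.Up x) :
    Tendsto (deriv (M.dualFun φ ψ)) (𝓝[>] 0) atBot := by
  obtain ⟨φ0, hlim, hor⟩ := h.exists_limit hr hμ hσ hρ hδ hy₀ hUp hx hφ₀
  have h1 : Tendsto (fun y => 1 / M.ρ * (1 - φ y / y)) (𝓝[>] 0) atBot :=
    (tendsto_atBot_add_const_left _ 1
      (tendsto_neg_atTop_atBot.comp (h.tendsto_div_atTop hy₀ hlim hor))).const_mul_atBot
      (by positivity)
  refine h1.congr' ?_
  filter_upwards [Ioo_mem_nhdsGT hy₀] with y hy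
  rw [(h.hasDerivAt_dualFun hμ hσ hρ hδ hUp hx hφ₀ hy).deriv]
  have := hy.1.ne'
  field_simp

end IsSystemSolution

theorem lam_neg (hμ : 0 < M.μ) (hσ : 0 < M.σ) (hδ : 0 < M.δ) : M.lam < 0 := by
  refine mul_neg_of_pos_of_neg (by positivity) (sub_neg.2 (Real.lt_sqrt_of_sq_lt ?_))
  have : 0 < 2 * M.δ * (M.μ ^ 2 / M.σ ^ 2) := by positivity
  linarith

theorem lam_quadratic (hμ : 0 < M.μ) (hσ : 0 < M.σ) (hδ : 0 < M.δ) :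
    M.μ ^ 2 / (2 * M.σ ^ 2) * M.lam ^ 2
      - (M.μ ^ 2 / (2 * M.σ ^ 2) + M.r + M.ρ - M.δ) * M.lam - M.δ = 0 := by
  set κ := M.μ ^ 2 / (2 * M.σ ^ 2) with hκ
  have hκpos : 0 < κ := by positivity
  have hinv : M.σ ^ 2 / M.μ ^ 2 = 1 / (2 * κ) := by rw [hκ]; field_simp
  have h4 : 2 * M.δ * (M.μ ^ 2 / M.σ ^ 2) = 4 * M.δ * κ := by rw [hκ]; field_simp; ring
  have hs := Real.sq_sqrt (show 0 ≤ (κ + M.r + M.ρ - M.δ) ^ 2 + 4 * M.δ * κ by positivity)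
  rw [lam, ← hκ, hinv, h4]
  set s := √((κ + M.r + M.ρ - M.δ) ^ 2 + 4 * M.δ * κ)
  field_simp
  linear_combination hs

end HabitModel
end

noncomputable section

/-! ### Sign lemmas for scalar differential equations. -/

section RealLemmas

variable {f f' : ℝ → ℝ}

theorem exists_neg_of_hasDerivWithinAt_neg {T d : ℝ} (hT : 0 < T)
    (hf : HasDerivWithinAt f d (Icc 0 T) 0) (h0 : f 0 = 0) (hd : d < 0) :
    ∃ t ∈ Icc 0 T, f t < 0 := by
  have h1 : HasDerivWithinAt f d (Ioi 0) 0 :=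
    hf.mono_of_mem_nhdsWithin (mem_of_superset (Ioc_mem_nhdsGT hT) Ioc_subset_Icc_self)
  rw [hasDerivWithinAt_iff_tendsto_slope' self_notMem_Ioi] at h1
  obtain ⟨t, hs, ht⟩ := ((h1.eventually_lt_const hd).and (Ioc_mem_nhdsGT hT)).exists
  refine ⟨t, Ioc_subset_Icc_self ht, ?_⟩
  rw [slope_def_field, h0, sub_zero, sub_zero, div_lt_iff₀ ht.1, zero_mul] at hs
  exact hs

/-- A function that has become negative stays negative, if on every interval where it is negative
its derivative stays nonpositive once it has been negative. -/
theorem neg_of_neg_of_deriv {T : ℝ} (hc : ContinuousOn f (Icc 0 T))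
    (hd : ∀ t ∈ Ioo 0 T, HasDerivAt f (f' t) t) (h0 : 0 ≤ f 0)
    (hmono : ∀ a b, 0 ≤ a → b ≤ T → (∀ t ∈ Ioo a b, f t < 0) →
      ∀ s ∈ Ioo a b, ∀ t ∈ Ioo a b, s < t → f' s < 0 → f' t ≤ 0)
    {t₁ t₂ : ℝ} (ht₁ : t₁ ∈ Icc 0 T) (hneg : f t₁ < 0) (ht₂ : t₂ ∈ Icc t₁ T) : f t₂ < 0 := by
  by_contra! hge
  -- `(a, b)` is the excursion below `0` around `t₁`. The mean value theorem on its two halves gives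
  -- a negative slope followed by a positive one, against `hmono`.
  obtain ⟨a, ⟨ha, hfa⟩, ha'⟩ : ∃ a, IsGreatest (Icc 0 t₁ ∩ f ⁻¹' Ici 0) a :=
    (isCompact_Icc.of_isClosed_subset ((hc.mono
      (Icc_subset_Icc_right ht₁.2)).preimage_isClosed_of_isClosed isClosed_Icc isClosed_Ici)
      inter_subset_left).exists_isGreatest ⟨0, ⟨le_rfl, ht₁.1⟩, h0⟩
  obtain ⟨b, ⟨hb, hfb⟩, hb'⟩ : ∃ b, IsLeast (Icc t₁ t₂ ∩ f ⁻¹' Ici 0) b :=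
    (isCompact_Icc.of_isClosed_subset ((hc.mono
      (Icc_subset_Icc ht₁.1 ht₂.2)).preimage_isClosed_of_isClosed isClosed_Icc isClosed_Ici)
      inter_subset_left).exists_isLeast ⟨t₂, ⟨ht₂.1, le_rfl⟩, hge⟩
  have hfa : 0 ≤ f a := hfa
  have hfb : 0 ≤ f b := hfb
  have hat : a < t₁ := lt_of_le_of_ne ha.2 (by rintro rfl; linarith)
  have htb : t₁ < b := lt_of_le_of_ne hb.1 (by rintro rfl; linarith)
  have hbT : b ≤ T := hb.2.trans ht₂.2
  have hab : ∀ t ∈ Ioo a b, f t < 0 := by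
    intro t ht
    by_contra! h
    rcases le_total t t₁ with h' | h'
    · exact ht.1.not_ge (ha' ⟨⟨ha.1.trans ht.1.le, h'⟩, h⟩)
    · exact ht.2.not_ge (hb' ⟨⟨h', ht.2.le.trans hb.2⟩, h⟩)
  obtain ⟨s, hs, hs'⟩ := exists_hasDerivAt_eq_slope f f' hat
    (hc.mono (Icc_subset_Icc ha.1 ht₁.2)) fun t ht => hd t ⟨ha.1.trans_lt ht.1, ht.2.trans_le ht₁.2⟩
  obtain ⟨t, ht, ht'⟩ := exists_hasDerivAt_eq_slope f f' htb
    (hc.mono (Icc_subset_Icc ht₁.1 hbT)) fun t ht => hd t ⟨ht₁.1.trans_lt ht.1, ht.2.trans_le hbT⟩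
  have h1 : f' s < 0 := by
    rw [hs']; exact div_neg_of_neg_of_pos (by linarith) (sub_pos.2 hat)
  have h2 : 0 < f' t := by
    rw [ht']; exact div_pos (by linarith) (sub_pos.2 htb)
  exact h2.not_ge (hmono a b ha.1 hbT hab s ⟨hs.1, hs.2.trans htb⟩ t ⟨hat.trans ht.1, ht.2⟩
    (hs.2.trans ht.1) h1)

/-- A nonnegative solution of `f' = S + h f` can not vanish where `S` is strictly decreasing. -/
theorem ne_zero_of_deriv_eq_add_mul {S h : ℝ → ℝ} {D t₁ : ℝ} (ht₁ : 0 < t₁)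
    (hd : ∀ t, 0 < t → HasDerivAt f (S t + h t * f t) t) (hnn : ∀ t, 0 ≤ t → 0 ≤ f t)
    (hh : ContinuousAt h t₁) (hS : HasDerivAt S D t₁) (hD : D < 0) : f t₁ ≠ 0 := by
  intro hz
  have hmin : IsLocalMin f t₁ := by
    filter_upwards [Ioi_mem_nhds ht₁] with t ht
    rw [hz]; exact hnn t (le_of_lt ht)
  have hS0 : S t₁ = 0 := by simpa [hz] using hmin.hasDerivAt_eq_zero (hd t₁ ht₁)
  have hSneg : ∀ᶠ t in 𝓝[>] t₁, S t < 0 := by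
    have h1 := hS.hasDerivWithinAt (s := Ioi t₁)
    rw [hasDerivWithinAt_iff_tendsto_slope' self_notMem_Ioi] at h1
    filter_upwards [h1.eventually_lt_const hD, self_mem_nhdsWithin] with t hs ht
    rw [slope_def_field, hS0, sub_zero, div_lt_iff₀ (sub_pos.2 ht), zero_mul] at hs
    exact hs
  have hhle : ∀ᶠ t in 𝓝[>] t₁, h t < h t₁ + 1 :=
    (hh.tendsto.eventually_lt_const (lt_add_one _)).filter_mono nhdsWithin_le_nhds
  obtain ⟨t₂, ht₂, hs⟩ := mem_nhdsGT_iff_exists_Ioo_subset.1 (hSneg.and hhle)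
  -- As `C` exceeds `h` just after `t₁`, where also `S < 0`, the function `f e^(-Ct)` strictly
  -- decreases from `0`, contradicting `f ≥ 0`.
  set C := h t₁ + 1
  have hg : ∀ t, 0 < t → HasDerivAt (fun t => f t * Real.exp (-C * t))
      ((S t + (h t - C) * f t) * Real.exp (-C * t)) t := by
    intro t ht
    have he : HasDerivAt (fun t => Real.exp (-C * t)) (Real.exp (-C * t) * (-C)) t := by
      simpa using ((hasDerivAt_id t).const_mul (-C)).exp
    refine ((hd t ht).mul he).congr_deriv ?_
    ring
  have hanti : StrictAntiOn (fun t => f t * Real.exp (-C * t)) (Ico t₁ t₂) := by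
    refine strictAntiOn_of_deriv_neg (convex_Ico _ _)
      (fun t ht => (hg t (ht₁.trans_le ht.1)).continuousAt.continuousWithinAt) fun t ht => ?_
    rw [interior_Ico] at ht
    rw [(hg t (ht₁.trans ht.1)).deriv]
    refine mul_neg_of_neg_of_pos ?_ (Real.exp_pos _)
    have h1 := (hs ht).1
    have h2 := mul_nonneg (sub_nonneg.2 (hs ht).2.le) (hnn t (ht₁.trans ht.1).le)
    linarith
  have ht₂ : t₁ < t₂ := ht₂
  have hlt : t₁ < (t₁ + t₂) / 2 := by linarith
  have := hanti ⟨le_rfl, ht₂⟩ ⟨hlt.le, by linarith⟩ hlt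
  simp only [hz, zero_mul] at this
  exact (mul_nonneg (hnn _ (ht₁.trans hlt).le) (Real.exp_pos _).le).not_gt this

/-- Homogeneity turns the Grönwall estimate into a Lipschitz bound in the shooting parameter. -/
theorem gronwallBound_mul (c δ K ε x : ℝ) :
    gronwallBound (c * δ) K (c * ε) x = c * gronwallBound δ K ε x := by
  unfold gronwallBound
  split_ifs <;> ring

end RealLemmas

/-- The free-boundary problem in logarithmic time, with `k = α + (U₊')⁻¹` and `l = -λ`. -/
structure ShootingProblem where
  κ : ℝ
  ρ : ℝ
  δ : ℝ
  R : ℝ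
  l : ℝ
  p₀ : ℝ
  k : ℝ → ℝ
  κ_pos : 0 < κ
  ρ_pos : 0 < ρ
  δ_pos : 0 < δ
  R_pos : 0 < R
  l_pos : 0 < l
  p₀_pos : 0 < p₀
  quadratic : κ * l ^ 2 + (κ + R - δ) * l - δ = 0
  k_pos : 0 < k p₀
  continuousOn_k : ContinuousOn k (Ioi 0)
  antitoneOn_k : AntitoneOn k (Ioi 0)
  hasDerivAt_k : ∀ p ∈ Ioo 0 p₀, ∃ d < 0, HasDerivAt k d p

/-! ### The clamped flow: existence, uniqueness and dependence on the parameter. -/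

namespace ShootingProblem

variable (P : ShootingProblem)

/-- The primitive of `ρ k + δ - R` vanishing at `p₀`. -/
def prim (p : ℝ) : ℝ := ∫ s in P.p₀..p, (P.ρ * P.k s + P.δ - P.R)

theorem prim_p₀ : P.prim P.p₀ = 0 := intervalIntegral.integral_same

theorem hasDerivAt_prim {p : ℝ} (hp : 0 < p) :
    HasDerivAt P.prim (P.ρ * P.k p + P.δ - P.R) p := by
  have hc : ContinuousOn (fun s => P.ρ * P.k s + P.δ - P.R) (Ioi 0) :=
    ((continuousOn_const.mul P.continuousOn_k).add continuousOn_const).sub continuousOn_const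
  refine intervalIntegral.integral_hasDerivAt_right ?_ ?_ (hc.continuousAt (Ioi_mem_nhds hp))
  · exact (hc.mono fun s hs => (lt_min P.p₀_pos hp).trans_le hs.1).intervalIntegrable
  · exact hc.stronglyMeasurableAtFilter isOpen_Ioi p hp

/-- `z = κ φ ψ` in terms of the state `(φ, β)`. -/
def z (x : ℝ × ℝ) : ℝ := x.2 + P.prim x.1

/-- The trajectories of the problem on `[0, T]`, with `z` clamped to `[0, κ φ]` in the field. -/
structure IsTrajectory (y₀ T : ℝ) (x : ℝ → ℝ × ℝ) : Prop where
  init : x 0 = (P.p₀, P.κ * (1 + P.l) * (P.p₀ - y₀))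
  deriv_fst : ∀ t ∈ Icc 0 T, HasDerivWithinAt (fun t => (x t).1)
    (-((x t).1 - max 0 (min (P.z (x t)) (P.κ * (x t).1)) / P.κ)) (Icc 0 T) t
  deriv_snd : ∀ t ∈ Icc 0 T, HasDerivWithinAt (fun t => (x t).2)
    (P.δ * (x t).1 - P.R * (y₀ * Real.exp (-t))) (Icc 0 T) t
  mem : ∀ t ∈ Icc 0 T, (x t).1 ∈ Icc (P.p₀ * Real.exp (-(2 * t))) P.p₀

/-- Clamping to `[ε, p₀]`. -/
def clamp (ε a : ℝ) : ℝ := max ε (min a P.p₀)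

/-- The globally Lipschitz truncation of the vector field. -/
def field (ε y₀ t : ℝ) (x : ℝ × ℝ) : ℝ × ℝ :=
  (-(P.clamp ε x.1 - max 0 (min (x.2 + P.prim (P.clamp ε x.1)) (P.κ * P.clamp ε x.1)) / P.κ),
    P.δ * P.clamp ε x.1 - P.R * (y₀ * Real.exp (-t)))

variable {P}

theorem clamp_mem {ε : ℝ} (h : ε ≤ P.p₀) (a : ℝ) : P.clamp ε a ∈ Icc ε P.p₀ :=
  ⟨le_max_left _ _, max_le h (min_le_right _ _)⟩

theorem clamp_of_mem {ε a : ℝ} (h : a ∈ Icc ε P.p₀) : P.clamp ε a = a := by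
  rw [clamp, min_eq_left h.2, max_eq_right h.1]

theorem lipschitzWith_clamp (ε : ℝ) : LipschitzWith 1 (P.clamp ε) :=
  (LipschitzWith.id.min_const _).const_max _

/-- The derivative `ρ k + δ - R` of the primitive is continuous, hence bounded on `[ε, p₀]`; no
Lipschitz bound on `k` is needed. -/
theorem exists_lipschitzWith_prim_clamp {ε : ℝ} (hε : 0 < ε) (h : ε ≤ P.p₀) :
    ∃ K, LipschitzWith K fun a => P.prim (P.clamp ε a) := by
  have hc : ContinuousOn (fun s => P.ρ * P.k s + P.δ - P.R) (Icc ε P.p₀) :=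
    ((continuousOn_const.mul (P.continuousOn_k.mono fun s hs => hε.trans_le hs.1)).add
      continuousOn_const).sub continuousOn_const
  obtain ⟨C, hC⟩ := isCompact_Icc.exists_bound_of_continuousOn hc
  have hL : LipschitzOnWith C.toNNReal P.prim (Icc ε P.p₀) :=
    (convex_Icc ε P.p₀).lipschitzOnWith_of_nnnorm_hasDerivWithin_le
      (fun s hs => (P.hasDerivAt_prim (hε.trans_le hs.1)).hasDerivWithinAt)
      fun s hs => by
        rw [← NNReal.coe_le_coe, coe_nnnorm]
        exact (hC s hs).trans (Real.le_coe_toNNReal C)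
  refine ⟨C.toNNReal * 1, ?_⟩
  rw [← lipschitzOnWith_univ]
  exact hL.comp (lipschitzWith_clamp ε).lipschitzOnWith fun a _ => clamp_mem h a

theorem exists_lipschitzWith_field {ε : ℝ} (hε : 0 < ε) (h : ε ≤ P.p₀) :
    ∃ K, ∀ y₀ t, LipschitzWith K (P.field ε y₀ t) := by
  obtain ⟨C, hC⟩ := exists_lipschitzWith_prim_clamp hε h
  have hcl : LipschitzWith (1 * 1) fun x : ℝ × ℝ => P.clamp ε x.1 :=
    (lipschitzWith_clamp ε).comp LipschitzWith.prod_fst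
  have hmul : ∀ c : ℝ, LipschitzWith ‖c‖₊ fun a : ℝ => c * a := fun c => lipschitzWith_smul c
  have hz := LipschitzWith.prod_snd.add (hC.comp (LipschitzWith.prod_fst (α := ℝ) (β := ℝ)))
  have h1 := (hcl.sub ((hmul P.κ⁻¹).comp ((hz.min ((hmul P.κ).comp hcl)).const_max 0))).neg
  have h2 := (hmul P.δ).comp hcl
  obtain ⟨_, h1'⟩ : ∃ K, LipschitzWith K fun x : ℝ × ℝ => -(P.clamp ε x.1
      - max 0 (min (x.2 + P.prim (P.clamp ε x.1)) (P.κ * P.clamp ε x.1)) / P.κ) := by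
    simp only [div_eq_inv_mul]
    exact ⟨_, h1⟩
  exact ⟨_, fun y₀ t => h1'.prodMk (h2.sub (LipschitzWith.const _))⟩

theorem norm_field_le {ε y₀ t : ℝ} (hε : 0 ≤ ε) (h : ε ≤ P.p₀) (hy₀ : 0 ≤ y₀) (ht : 0 ≤ t)
    (x : ℝ × ℝ) : ‖P.field ε y₀ t x‖ ≤ P.p₀ + P.δ * P.p₀ + P.R * y₀ := by
  have hcl := clamp_mem h x.1
  have hκ := P.κ_pos
  have hδ := P.δ_pos
  have hR := P.R_pos
  have hp := P.p₀_pos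
  have hc0 : 0 ≤ P.clamp ε x.1 := hε.trans hcl.1
  have he : Real.exp (-t) ≤ 1 := Real.exp_le_one_iff.2 (by linarith)
  have he0 := Real.exp_pos (-t)
  have h1 : y₀ * Real.exp (-t) ≤ y₀ := mul_le_of_le_one_right hy₀ he
  have h2 : 0 ≤ y₀ * Real.exp (-t) := by positivity
  have h3 : 0 ≤ P.δ * P.p₀ := by positivity
  have h4 : 0 ≤ P.R * y₀ := by positivity
  have h5 : P.δ * P.clamp ε x.1 ≤ P.δ * P.p₀ := by gcongr; exact hcl.2
  have h6 : 0 ≤ P.δ * P.clamp ε x.1 := by positivity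
  have h7 : P.R * (y₀ * Real.exp (-t)) ≤ P.R * y₀ := by gcongr
  have h8 : 0 ≤ P.R * (y₀ * Real.exp (-t)) := by positivity
  refine max_le ?_ ?_ <;> rw [Real.norm_eq_abs, abs_le] <;> simp only [field]
  · have h9 : max 0 (min (x.2 + P.prim (P.clamp ε x.1)) (P.κ * P.clamp ε x.1)) / P.κ
        ≤ P.clamp ε x.1 := by
      rw [div_le_iff₀' hκ]
      exact max_le (by positivity) (min_le_right _ _)
    have h10 : 0 ≤ max 0 (min (x.2 + P.prim (P.clamp ε x.1)) (P.κ * P.clamp ε x.1)) / P.κ :=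
      div_nonneg (le_max_left _ _) hκ.le
    constructor <;> linarith [hcl.2]
  · constructor <;> linarith

theorem hasDerivWithinAt_Ici {E : Type*} [NormedAddCommGroup E] [NormedSpace ℝ E] {f : ℝ → E}
    {f' : E} {t T : ℝ} (ht : t ∈ Ico 0 T) (hf : HasDerivWithinAt f f' (Icc 0 T) t) :
    HasDerivWithinAt f f' (Ici t) t :=
  hf.mono_of_mem_nhdsWithin (mem_of_superset (Icc_mem_nhdsGE ht.2) (Icc_subset_Icc_left ht.1))

/-- Picard–Lindelöf for the truncated field on all of `[0, T]`, then a priori bounds on `φ` showing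
that the truncation is inactive. -/
theorem exists_isTrajectory {y₀ T : ℝ} (hy₀ : 0 ≤ y₀) (hT : 0 ≤ T) :
    ∃ x, P.IsTrajectory y₀ T x := by
  have hp := P.p₀_pos
  have hκ := P.κ_pos
  set ε := P.p₀ * Real.exp (-(2 * T)) with hεdef
  have hε : 0 < ε := mul_pos P.p₀_pos (Real.exp_pos _)
  have hεp : ε ≤ P.p₀ := mul_le_of_le_one_right hp.le (Real.exp_le_one_iff.2 (by linarith))
  obtain ⟨K, hK⟩ := exists_lipschitzWith_field hε hεp
  have hL : 0 ≤ P.p₀ + P.δ * P.p₀ + P.R * y₀ := by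
    have := P.δ_pos
    have := P.R_pos
    positivity
  obtain ⟨x, hx0, hx⟩ := IsPicardLindelof.exists_eq_forall_mem_Icc_hasDerivWithinAt₀
    (f := P.field ε y₀) (tmin := 0) (tmax := T) (t₀ := ⟨0, le_rfl, hT⟩)
    (x₀ := (P.p₀, P.κ * (1 + P.l) * (P.p₀ - y₀)))
    -- The field is bounded by `L`, so a ball of radius `L T` is not left before time `T`.
    (a := (P.p₀ + P.δ * P.p₀ + P.R * y₀).toNNReal * T.toNNReal)
    (L := (P.p₀ + P.δ * P.p₀ + P.R * y₀).toNNReal) (K := K)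
    { lipschitzOnWith := fun t _ => (hK y₀ t).lipschitzOnWith
      continuousOn := fun x _ => by unfold field; fun_prop
      norm_le := fun t ht x _ => by
        rw [Real.coe_toNNReal _ hL]
        exact norm_field_le hε.le hεp hy₀ ht.1 x
      mul_max_le := by simp [hT] }
  have hx0 : x 0 = (P.p₀, P.κ * (1 + P.l) * (P.p₀ - y₀)) := hx0
  have h1 : ∀ t ∈ Icc 0 T, HasDerivWithinAt (fun t => (x t).1) (P.field ε y₀ t (x t)).1
      (Icc 0 T) t := fun t ht => (hx t ht).fst
  have h2 : ∀ t ∈ Icc 0 T, HasDerivWithinAt (fun t => (x t).2) (P.field ε y₀ t (x t)).2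
      (Icc 0 T) t := fun t ht => (hx t ht).snd
  have hcont : ContinuousOn (fun t => (x t).1) (Icc 0 T) :=
    fun t ht => (h1 t ht).continuousWithinAt
  have hmem : ∀ t ∈ Icc 0 T, (x t).1 ∈ Icc (P.p₀ * Real.exp (-(2 * t))) P.p₀ := by
    intro t ht
    constructor
    -- Clamping gives `φ' ≥ -φ` at a contact point; the rate `2` instead of `1` supplies the strict
    -- inequality that the comparison requires.
    · have hB : ∀ t : ℝ, HasDerivAt (fun t => -(P.p₀ * Real.exp (-(2 * t))))
          (2 * (P.p₀ * Real.exp (-(2 * t)))) t := by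
        intro t
        have := ((((hasDerivAt_id t).const_mul 2).neg).exp.const_mul P.p₀).neg
        refine this.congr_deriv ?_
        simp
        ring
      have := image_le_of_deriv_right_lt_deriv_boundary hcont.neg
        (fun t ht => (hasDerivWithinAt_Ici ht (h1 t (Ico_subset_Icc_self ht))).neg)
        (by simp [hx0]) hB (fun t ht heq => ?_) ht
      · simpa using this
      · have heq : (x t).1 = P.p₀ * Real.exp (-(2 * t)) := by simpa using heq
        have hpos : 0 < (x t).1 := by rw [heq]; positivity
        have hcl : P.clamp ε (x t).1 = (x t).1 := by
          refine clamp_of_mem ⟨?_, ?_⟩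
          · rw [heq, hεdef]
            have := ht.2
            gcongr
          · rw [heq]
            exact mul_le_of_le_one_right hp.le (Real.exp_le_one_iff.2 (by linarith [ht.1]))
        rw [← heq]
        simp only [field, hcl]
        have h10 : 0 ≤ max 0 (min ((x t).2 + P.prim (x t).1) (P.κ * (x t).1)) / P.κ :=
          div_nonneg (le_max_left _ _) hκ.le
        linarith
    · have hanti : AntitoneOn (fun t => (x t).1) (Icc 0 T) := by
        refine antitoneOn_of_deriv_nonpos (convex_Icc 0 T) hcont (fun t ht => ?_) fun t ht => ?_ <;>
          rw [interior_Icc] at ht <;>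
          have hd := (h1 t (Ioo_subset_Icc_self ht)).hasDerivAt (Icc_mem_nhds ht.1 ht.2)
        · exact hd.differentiableAt.differentiableWithinAt
        · rw [hd.deriv]
          have hcl := clamp_mem hεp (x t).1
          simp only [field]
          rw [neg_nonpos, sub_nonneg, div_le_iff₀' hκ]
          exact max_le (mul_nonneg hκ.le (hε.le.trans hcl.1)) (min_le_right _ _)
      simpa [hx0] using hanti ⟨le_rfl, hT⟩ ht ht.1
  have hcl : ∀ t ∈ Icc 0 T, P.clamp ε (x t).1 = (x t).1 := by
    refine fun t ht => clamp_of_mem ⟨le_trans ?_ (hmem t ht).1, (hmem t ht).2⟩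
    have := ht.2
    rw [hεdef]
    gcongr
  refine ⟨x, hx0, fun t ht => ?_, fun t ht => ?_, hmem⟩
  · simpa only [field, hcl t ht] using! h1 t ht
  · simpa only [field, hcl t ht] using! h2 t ht

namespace IsTrajectory

variable {y₀ T : ℝ} {x : ℝ → ℝ × ℝ}

theorem pos (hx : P.IsTrajectory y₀ T x) {t : ℝ} (ht : t ∈ Icc 0 T) : 0 < (x t).1 :=
  (mul_pos P.p₀_pos (Real.exp_pos _)).trans_le (hx.mem t ht).1

theorem restrict (hx : P.IsTrajectory y₀ T x) {S : ℝ} (hS : S ≤ T) : P.IsTrajectory y₀ S x where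
  init := hx.init
  deriv_fst t ht := (hx.deriv_fst t (Icc_subset_Icc_right hS ht)).mono (Icc_subset_Icc_right hS)
  deriv_snd t ht := (hx.deriv_snd t (Icc_subset_Icc_right hS ht)).mono (Icc_subset_Icc_right hS)
  mem t ht := hx.mem t (Icc_subset_Icc_right hS ht)

theorem hasDerivWithinAt (hx : P.IsTrajectory y₀ T x) {t : ℝ} (ht : t ∈ Icc 0 T) :
    HasDerivWithinAt x (P.field (P.p₀ * Real.exp (-(2 * T))) y₀ t (x t)) (Icc 0 T) t := by
  have hcl : P.clamp (P.p₀ * Real.exp (-(2 * T))) (x t).1 = (x t).1 := by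
    refine clamp_of_mem ⟨le_trans ?_ (hx.mem t ht).1, (hx.mem t ht).2⟩
    have := ht.2
    have := P.p₀_pos
    gcongr
  have := (hx.deriv_fst t ht).prodMk (hx.deriv_snd t ht)
  simpa only [field, hcl] using! this

end IsTrajectory

theorem exists_dist_le {T : ℝ} (hT : 0 ≤ T) : ∃ C, ∀ y₀ y₁ x x',
    P.IsTrajectory y₀ T x → P.IsTrajectory y₁ T x' → ∀ t ∈ Icc 0 T,
      dist (x t) (x' t) ≤ C * dist y₀ y₁ := by
  have hp := P.p₀_pos
  have hR := P.R_pos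
  have hκ := P.κ_pos
  have hl := P.l_pos
  obtain ⟨K, hK⟩ := exists_lipschitzWith_field (P := P)
    (mul_pos hp (Real.exp_pos (-(2 * T))))
    (mul_le_of_le_one_right hp.le (Real.exp_le_one_iff.2 (by linarith)))
  -- The parameter shifts the initial point by `κ (1 + l) |y₀ - y₁|` and the field by at most `R |y₀
  -- - y₁|`.
  refine ⟨gronwallBound (P.κ * (1 + P.l)) K P.R T, fun y₀ y₁ x x' hx hx' t ht => ?_⟩
  have h := dist_le_of_approx_trajectories_ODE (hK y₀)
    (f := x) (g := x') (a := 0) (b := T) (εf := 0) (εg := dist y₀ y₁ * P.R)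
    (δ := dist y₀ y₁ * (P.κ * (1 + P.l)))
    (fun t ht => (hx.hasDerivWithinAt ht).continuousWithinAt)
    (fun t ht => hasDerivWithinAt_Ici ht (hx.hasDerivWithinAt (Ico_subset_Icc_self ht)))
    (fun t _ => (dist_self _).le)
    (fun t ht => (hx'.hasDerivWithinAt ht).continuousWithinAt)
    (fun t ht => hasDerivWithinAt_Ici ht (hx'.hasDerivWithinAt (Ico_subset_Icc_self ht)))
    (fun t ht => ?_) ?_ t ht
  · rw [zero_add, gronwallBound_mul, sub_zero] at h
    refine h.trans ?_
    rw [mul_comm]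
    gcongr
    exact gronwallBound_mono (by positivity) hR.le K.2 ht.2
  · have he : Real.exp (-t) ≤ 1 := Real.exp_le_one_iff.2 (by linarith [ht.1])
    simp only [field, Prod.dist_eq, dist_self]
    refine max_le (by positivity) ?_
    rw [Real.dist_eq, Real.dist_eq]
    have : P.δ * P.clamp (P.p₀ * Real.exp (-(2 * T))) (x' t).1 - P.R * (y₁ * Real.exp (-t))
      - (P.δ * P.clamp (P.p₀ * Real.exp (-(2 * T))) (x' t).1 - P.R * (y₀ * Real.exp (-t)))
      = (y₀ - y₁) * P.R * Real.exp (-t) := by ring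
    rw [this, abs_mul, abs_mul, abs_of_pos hR, abs_of_pos (Real.exp_pos _)]
    exact mul_le_of_le_one_right (by positivity) he
  · rw [hx.init, hx'.init, Prod.dist_eq, dist_self]
    refine max_le (by positivity) ?_
    rw [Real.dist_eq, Real.dist_eq]
    have : P.κ * (1 + P.l) * (P.p₀ - y₀) - P.κ * (1 + P.l) * (P.p₀ - y₁)
      = -((y₀ - y₁) * (P.κ * (1 + P.l))) := by ring
    rw [this, abs_neg, abs_mul, abs_of_pos (show 0 < P.κ * (1 + P.l) by positivity)]

theorem IsTrajectory.eq {y₀ T : ℝ} {x x' : ℝ → ℝ × ℝ} (hx : P.IsTrajectory y₀ T x)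
    (hx' : P.IsTrajectory y₀ T x') {t : ℝ} (ht : t ∈ Icc 0 T) : x t = x' t := by
  obtain ⟨C, hC⟩ := exists_dist_le (P := P) (ht.1.trans ht.2)
  simpa using hC y₀ y₀ x x' hx hx' t ht

end ShootingProblem
end

noncomputable section

/-! ### The shooting argument. -/

namespace ShootingProblem

variable {P : ShootingProblem}

/-- The lower end of the range of the free boundary. -/
def y₁ (P : ShootingProblem) : ℝ := P.p₀ * P.l / (1 + P.l)

theorem y₁_pos : 0 < P.y₁ :=
  div_pos (mul_pos P.p₀_pos P.l_pos) (by linarith [P.l_pos])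

theorem y₁_le : P.y₁ ≤ P.p₀ := by
  have hl := P.l_pos
  have hp := P.p₀_pos
  rw [y₁, div_le_iff₀ (by linarith)]
  linarith

/-- At the lower end the trajectories leave through `z = κ φ`. -/
theorem R_mul_y₁_lt : P.R * P.y₁ < P.δ * P.p₀ := by
  have hl := P.l_pos
  have hκ := P.κ_pos
  have hp := P.p₀_pos
  rw [y₁, mul_div_assoc', div_lt_iff₀ (by linarith)]
  have hq := P.quadratic
  have : P.R * P.l < P.δ * (1 + P.l) := by nlinarith [mul_pos hκ hl, mul_pos (mul_pos hκ hl) hl]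
  nlinarith

theorem continuousAt_z {x : ℝ × ℝ} (hx : 0 < x.1) : ContinuousAt P.z x :=
  continuousAt_snd.add
    (ContinuousAt.comp (f := Prod.fst) (g := P.prim) (P.hasDerivAt_prim hx).continuousAt
      continuousAt_fst)

namespace IsTrajectory

variable {y₀ T : ℝ} {x : ℝ → ℝ × ℝ}

theorem hasDerivWithinAt_z (hx : P.IsTrajectory y₀ T x) {t : ℝ} (ht : t ∈ Icc 0 T) :
    HasDerivWithinAt (fun t => P.z (x t)) (P.δ * (x t).1 - P.R * (y₀ * Real.exp (-t))
      + (P.ρ * P.k (x t).1 + P.δ - P.R)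
        * -((x t).1 - max 0 (min (P.z (x t)) (P.κ * (x t).1)) / P.κ)) (Icc 0 T) t :=
  (hx.deriv_snd t ht).add
    (HasDerivAt.comp_hasDerivWithinAt (h₂ := P.prim) t (P.hasDerivAt_prim (hx.pos ht))
      (hx.deriv_fst t ht))

theorem z_zero (hx : P.IsTrajectory y₀ T x) : P.z (x 0) = P.κ * (1 + P.l) * (P.p₀ - y₀) := by
  rw [z, hx.init, prim_p₀, add_zero]

theorem hasDerivWithinAt_gap (hx : P.IsTrajectory y₀ T x) {t : ℝ} (ht : t ∈ Icc 0 T) :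
    HasDerivWithinAt (fun t => P.κ * (x t).1 - P.z (x t))
      (P.κ * -((x t).1 - max 0 (min (P.z (x t)) (P.κ * (x t).1)) / P.κ)
        - (P.δ * (x t).1 - P.R * (y₀ * Real.exp (-t)) + (P.ρ * P.k (x t).1 + P.δ - P.R)
        * -((x t).1 - max 0 (min (P.z (x t)) (P.κ * (x t).1)) / P.κ))) (Icc 0 T) t :=
  ((hx.deriv_fst t ht).const_mul P.κ).sub (hx.hasDerivWithinAt_z ht)

theorem gap_zero (hx : P.IsTrajectory y₀ T x) :
    P.κ * (x 0).1 - P.z (x 0) = P.κ * (1 + P.l) * (y₀ - P.y₁) := by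
  have := P.l_pos
  rw [hx.z_zero, hx.init, y₁]
  field_simp
  ring

/-- Below the band the clamped equation is `φ' = -φ`, so `φ = c e⁻ᵗ` and `z' = e⁻ᵗ (c (R - ρ k(φ)) -
R y₀)`. The bracket is antitone in time because `φ` decreases and `k` is antitone. -/
theorem z_neg_of_neg (hx : P.IsTrajectory y₀ T x) (h0 : 0 ≤ P.z (x 0)) {t₁ t₂ : ℝ}
    (ht₁ : t₁ ∈ Icc 0 T) (hneg : P.z (x t₁) < 0) (ht₂ : t₂ ∈ Icc t₁ T) : P.z (x t₂) < 0 := by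
  refine neg_of_neg_of_deriv (f := fun t => P.z (x t))
    (fun t ht => (hx.hasDerivWithinAt_z ht).continuousWithinAt)
    (fun t ht => (hx.hasDerivWithinAt_z (Ioo_subset_Icc_self ht)).hasDerivAt
      (Icc_mem_nhds ht.1 ht.2)) h0 ?_ ht₁ hneg ht₂
  intro a b ha hb hab s hs t ht hst hs'
  have hsub : Ioo a b ⊆ Icc 0 T := fun u hu => ⟨ha.trans hu.1.le, hu.2.le.trans hb⟩
  have hcl : ∀ u ∈ Ioo a b, max 0 (min (P.z (x u)) (P.κ * (x u).1)) = 0 := fun u hu =>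
    max_eq_left ((min_le_left _ _).trans (hab u hu).le)
  have hst' : Icc s t ⊆ Ioo a b := fun u hu => ⟨hs.1.trans_le hu.1, hu.2.trans_lt ht.2⟩
  have hder : ∀ u ∈ Icc s t,
      HasDerivWithinAt (fun u => (x u).1 * Real.exp u) 0 (Icc 0 T) u := by
    intro u hu
    have := hx.deriv_fst u (hsub (hst' hu))
    rw [hcl u (hst' hu)] at this
    refine (this.mul (Real.hasDerivAt_exp u).hasDerivWithinAt).congr_deriv ?_
    ring
  have hconst := constant_of_has_deriv_right_zero (a := s) (b := t)
    (fun u hu => (hder u hu).continuousWithinAt.mono (hst'.trans hsub))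
    (fun u hu => hasDerivWithinAt_Ici
      ⟨(hsub (hst' (Ico_subset_Icc_self hu))).1, hu.2.trans_le (hsub ht).2⟩
      (hder u (Ico_subset_Icc_self hu))) t ⟨hst.le, le_rfl⟩
  have hxs := hx.pos (hsub hs)
  have hxt := hx.pos (hsub ht)
  set c := (x s).1 * Real.exp s with hc
  have hcpos : 0 < c := mul_pos hxs (Real.exp_pos _)
  have es : (x s).1 = c * Real.exp (-s) := by rw [hc, mul_assoc, ← Real.exp_add]; simp
  have et : (x t).1 = c * Real.exp (-t) := by rw [← hconst, mul_assoc, ← Real.exp_add]; simp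
  have hle : (x t).1 ≤ (x s).1 := by
    rw [es, et]
    gcongr
  have hk : P.ρ * P.k (x s).1 ≤ P.ρ * P.k (x t).1 :=
    mul_le_mul_of_nonneg_left (P.antitoneOn_k hxt hxs hle) P.ρ_pos.le
  rw [hcl s hs] at hs'
  rw [hcl t ht]
  have h1 : Real.exp (-s) * (c * (P.R - P.ρ * P.k (x s).1) - P.R * y₀) < 0 := by
    refine lt_of_eq_of_lt ?_ hs'
    rw [es]; ring
  have h2 : c * (P.R - P.ρ * P.k (x s).1) - P.R * y₀ < 0 := by
    by_contra! h
    exact h1.not_ge (mul_nonneg (Real.exp_pos _).le h)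
  have h3 : c * (P.R - P.ρ * P.k (x t).1) ≤ c * (P.R - P.ρ * P.k (x s).1) := by gcongr
  have h4 : Real.exp (-t) * (c * (P.R - P.ρ * P.k (x t).1) - P.R * y₀) ≤ 0 :=
    mul_nonpos_of_nonneg_of_nonpos (Real.exp_pos _).le (by linarith)
  refine le_of_eq_of_le ?_ h4
  rw [et]; ring

/-- Above the band `φ` is frozen and the gap has derivative `R y₀ e⁻ᵗ - δ φ`, which is antitone in
time. -/
theorem gap_neg_of_neg (hx : P.IsTrajectory y₀ T x) (hy₀ : 0 ≤ y₀)
    (h0 : 0 ≤ P.κ * (x 0).1 - P.z (x 0)) {t₁ t₂ : ℝ} (ht₁ : t₁ ∈ Icc 0 T)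
    (hneg : P.κ * (x t₁).1 - P.z (x t₁) < 0) (ht₂ : t₂ ∈ Icc t₁ T) :
    P.κ * (x t₂).1 - P.z (x t₂) < 0 := by
  have hκ := P.κ_pos
  refine neg_of_neg_of_deriv (f := fun t => P.κ * (x t).1 - P.z (x t))
    (fun t ht => (hx.hasDerivWithinAt_gap ht).continuousWithinAt)
    (fun t ht => (hx.hasDerivWithinAt_gap (Ioo_subset_Icc_self ht)).hasDerivAt
      (Icc_mem_nhds ht.1 ht.2)) h0 ?_ ht₁ hneg ht₂
  intro a b ha hb hab s hs t ht hst hs'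
  have hsub : Ioo a b ⊆ Icc 0 T := fun u hu => ⟨ha.trans hu.1.le, hu.2.le.trans hb⟩
  have hcl : ∀ u ∈ Ioo a b,
      (x u).1 - max 0 (min (P.z (x u)) (P.κ * (x u).1)) / P.κ = 0 := by
    intro u hu
    have := hx.pos (hsub hu)
    rw [min_eq_right (by linarith [hab u hu]), max_eq_right (by positivity)]
    field_simp
    ring
  have hst' : Icc s t ⊆ Ioo a b := fun u hu => ⟨hs.1.trans_le hu.1, hu.2.trans_lt ht.2⟩
  have hder : ∀ u ∈ Icc s t, HasDerivWithinAt (fun u => (x u).1) 0 (Icc 0 T) u := by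
    intro u hu
    have := hx.deriv_fst u (hsub (hst' hu))
    rwa [hcl u (hst' hu), neg_zero] at this
  have hconst := constant_of_has_deriv_right_zero (a := s) (b := t)
    (fun u hu => (hder u hu).continuousWithinAt.mono (hst'.trans hsub))
    (fun u hu => hasDerivWithinAt_Ici
      ⟨(hsub (hst' (Ico_subset_Icc_self hu))).1, hu.2.trans_le (hsub ht).2⟩
      (hder u (Ico_subset_Icc_self hu))) t ⟨hst.le, le_rfl⟩
  rw [hcl s hs] at hs'
  rw [hcl t ht, hconst]
  have hR := P.R_pos
  have h1 : P.R * (y₀ * Real.exp (-t)) ≤ P.R * (y₀ * Real.exp (-s)) := by gcongr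
  linarith

theorem exists_z_neg (hx : P.IsTrajectory P.p₀ T x) (hT : 0 < T) :
    ∃ t ∈ Icc 0 T, P.z (x t) < 0 := by
  have h0 : P.z (x 0) = 0 := by rw [hx.z_zero, sub_self, mul_zero]
  refine exists_neg_of_hasDerivWithinAt_neg hT (hx.hasDerivWithinAt_z ⟨le_rfl, hT.le⟩) h0 ?_
  have hp := P.p₀_pos
  have hk := mul_pos (mul_pos P.ρ_pos P.k_pos) hp
  rw [h0, hx.init]
  simp only [neg_zero, Real.exp_zero]
  rw [max_eq_left (min_le_left _ _), zero_div]
  linarith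

theorem exists_gap_neg (hx : P.IsTrajectory P.y₁ T x) (hT : 0 < T) :
    ∃ t ∈ Icc 0 T, P.κ * (x t).1 - P.z (x t) < 0 := by
  have h0 : P.κ * (x 0).1 - P.z (x 0) = 0 := by rw [hx.gap_zero, sub_self, mul_zero]
  refine exists_neg_of_hasDerivWithinAt_neg hT (hx.hasDerivWithinAt_gap ⟨le_rfl, hT.le⟩) h0 ?_
  have hp := P.p₀_pos
  have hκ := P.κ_pos
  have hz : P.z (x 0) = P.κ * (x 0).1 := by linarith
  rw [hz, hx.init]
  simp only [neg_zero, Real.exp_zero, min_self]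
  rw [max_eq_right (by positivity), mul_div_cancel_left₀ _ hκ.ne']
  linarith [R_mul_y₁_lt (P := P)]

end IsTrajectory

/-- The free boundaries for which the trajectory stays in `0 ≤ z ≤ κ φ` up to time `T`. -/
def admissible (P : ShootingProblem) (T : ℝ) : Set ℝ :=
  {y₀ ∈ Icc P.y₁ P.p₀ | ∀ x, P.IsTrajectory y₀ T x →
    ∀ t ∈ Icc 0 T, P.z (x t) ∈ Icc 0 (P.κ * (x t).1)}

theorem continuousOn_of_isTrajectory {T : ℝ} {X : ℝ → ℝ → ℝ × ℝ}
    (hX : ∀ y₀ ∈ Icc P.y₁ P.p₀, P.IsTrajectory y₀ T (X y₀)) {t : ℝ} (ht : t ∈ Icc 0 T) :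
    ContinuousOn (fun y₀ => X y₀ t) (Icc P.y₁ P.p₀) := by
  obtain ⟨C, hC⟩ := exists_dist_le (P := P) (ht.1.trans ht.2)
  refine LipschitzOnWith.continuousOn (K := C.toNNReal) (LipschitzOnWith.of_dist_le_mul ?_)
  intro y hy y' hy'
  refine (hC y y' _ _ (hX y hy) (hX y' hy') t ht).trans ?_
  gcongr
  exact Real.le_coe_toNNReal C

theorem continuousOn_z {T : ℝ} {X : ℝ → ℝ → ℝ × ℝ}
    (hX : ∀ y₀ ∈ Icc P.y₁ P.p₀, P.IsTrajectory y₀ T (X y₀)) {t : ℝ} (ht : t ∈ Icc 0 T) :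
    ContinuousOn (fun y₀ => P.z (X y₀ t)) (Icc P.y₁ P.p₀) := fun y hy =>
  ContinuousAt.comp_continuousWithinAt (g := P.z) (f := fun y₀ => X y₀ t)
    (continuousAt_z ((hX y hy).pos ht)) (continuousOn_of_isTrajectory hX ht y hy)

theorem exists_flow {T : ℝ} (hT : 0 ≤ T) :
    ∃ X : ℝ → ℝ → ℝ × ℝ, ∀ y₀ ∈ Icc P.y₁ P.p₀, P.IsTrajectory y₀ T (X y₀) := by
  choose! X hX using fun (y₀ : ℝ) (h : 0 ≤ y₀) => exists_isTrajectory (P := P) h hT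
  exact ⟨X, fun y₀ h => hX y₀ (y₁_pos.le.trans h.1)⟩

theorem isClosed_admissible {T : ℝ} (hT : 0 ≤ T) : IsClosed (P.admissible T) := by
  obtain ⟨X, hX⟩ := exists_flow (P := P) hT
  have heq : P.admissible T = Icc P.y₁ P.p₀ ∩ ⋂ t ∈ Icc 0 T,
      (Icc P.y₁ P.p₀ ∩ (fun y₀ => P.z (X y₀ t)) ⁻¹' Ici 0) ∩
      (Icc P.y₁ P.p₀ ∩ (fun y₀ => P.κ * (X y₀ t).1 - P.z (X y₀ t)) ⁻¹' Ici 0) := by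
    ext y
    simp only [admissible, mem_inter_iff, mem_iInter, mem_preimage, mem_Ici, sub_nonneg]
    constructor
    · rintro ⟨hy, h⟩
      exact ⟨hy, fun t ht => ⟨⟨hy, (h _ (hX y hy) t ht).1⟩, hy, (h _ (hX y hy) t ht).2⟩⟩
    · rintro ⟨hy, h⟩
      refine ⟨hy, fun x hx t ht => ?_⟩
      rw [hx.eq (hX y hy) ht]
      exact ⟨(h t ht).1.2, (h t ht).2.2⟩
  rw [heq]
  refine isClosed_Icc.inter (isClosed_biInter fun t ht => IsClosed.inter ?_ ?_)
  · exact (continuousOn_z hX ht).preimage_isClosed_of_isClosed isClosed_Icc isClosed_Ici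
  · exact ((continuousOn_const.mul (continuousOn_of_isTrajectory hX ht).fst).sub
      (continuousOn_z hX ht)).preimage_isClosed_of_isClosed isClosed_Icc isClosed_Ici

theorem nonempty_admissible {T : ℝ} (hT : 0 < T) : (P.admissible T).Nonempty := by
  obtain ⟨X, hX⟩ := exists_flow (P := P) hT.le
  have hκl : 0 < P.κ * (1 + P.l) := mul_pos P.κ_pos (by linarith [P.l_pos])
  have hTm : T ∈ Icc 0 T := ⟨hT.le, le_rfl⟩
  have hz0 : ∀ y ∈ Icc P.y₁ P.p₀, 0 ≤ P.z (X y 0) := fun y hy => by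
    rw [(hX y hy).z_zero]; exact mul_nonneg hκl.le (sub_nonneg.2 hy.2)
  have hg0 : ∀ y ∈ Icc P.y₁ P.p₀, 0 ≤ P.κ * (X y 0).1 - P.z (X y 0) := fun y hy => by
    rw [(hX y hy).gap_zero]; exact mul_nonneg hκl.le (sub_nonneg.2 hy.1)
  have hr : P.p₀ ∈ Icc P.y₁ P.p₀ := ⟨y₁_le, le_rfl⟩
  have hl : P.y₁ ∈ Icc P.y₁ P.p₀ := ⟨le_rfl, y₁_le⟩
  have hright : P.z (X P.p₀ T) < 0 := by
    obtain ⟨t, ht, h⟩ := (hX _ hr).exists_z_neg hT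
    exact (hX _ hr).z_neg_of_neg (hz0 _ hr) ht h ⟨ht.2, le_rfl⟩
  have hleft : P.κ * (X P.y₁ T).1 - P.z (X P.y₁ T) < 0 := by
    obtain ⟨t, ht, h⟩ := (hX _ hl).exists_gap_neg hT
    exact (hX _ hl).gap_neg_of_neg y₁_pos.le (hg0 _ hl) ht h ⟨ht.2, le_rfl⟩
  have hκ := P.κ_pos
  have hpos : ∀ y ∈ Icc P.y₁ P.p₀, 0 < P.κ * (X y T).1 := fun y hy =>
    mul_pos hκ ((hX y hy).pos hTm)
  -- Aim at the middle of the band at time `T`. As no trajectory re-enters, being inside at `T`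
  -- means having been inside throughout `[0, T]`.
  obtain ⟨y, hy, hy0⟩ := intermediate_value_Icc' (y₁_le (P := P))
    (f := fun y => P.z (X y T) - P.κ * (X y T).1 / 2)
    ((continuousOn_z hX hTm).sub
      ((continuousOn_const.mul (continuousOn_of_isTrajectory hX hTm).fst).div_const 2))
    (show (0 : ℝ) ∈ Icc _ _ from ⟨by linarith [hpos _ hr], by linarith [hpos _ hl]⟩)
  simp only at hy0
  have hy0' := hpos y hy
  refine ⟨y, hy, fun x hx t ht => ?_⟩
  rw [hx.eq (hX y hy) ht]
  constructor
  · by_contra! h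
    have := (hX y hy).z_neg_of_neg (hz0 y hy) ht h ⟨ht.2, le_rfl⟩
    linarith
  · by_contra! h
    have := (hX y hy).gap_neg_of_neg (y₁_pos.le.trans hy.1) (hg0 y hy) ht (sub_neg.2 h)
      ⟨ht.2, le_rfl⟩
    linarith

theorem admissible_subset {S T : ℝ} (hS : 0 ≤ S) (h : S ≤ T) :
    P.admissible T ⊆ P.admissible S := by
  rintro y ⟨hy, hadm⟩
  refine ⟨hy, fun x hx t ht => ?_⟩
  obtain ⟨x', hx'⟩ := exists_isTrajectory (P := P) (y₁_pos.le.trans hy.1) (hS.trans h)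
  rw [hx.eq (hx'.restrict h) ht]
  exact hadm x' hx' t ⟨ht.1, ht.2.trans h⟩

/-- Some trajectory stays in `0 ≤ z ≤ κ φ` forever. -/
theorem exists_global_trajectory (P : ShootingProblem) :
    ∃ y₀ ∈ Icc P.y₁ P.p₀, ∃ x : ℝ → ℝ × ℝ, ∀ T, 0 ≤ T → P.IsTrajectory y₀ T x ∧
      ∀ t ∈ Icc 0 T, P.z (x t) ∈ Icc 0 (P.κ * (x t).1) := by
  have hcomp : IsCompact (P.admissible ((0 : ℕ) + 1)) :=
    isCompact_Icc.of_isClosed_subset (isClosed_admissible (by positivity)) fun y hy => hy.1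
  obtain ⟨y₀, hy₀⟩ := IsCompact.nonempty_iInter_of_sequence_nonempty_isCompact_isClosed
    (fun n : ℕ => P.admissible (n + 1))
    (fun n => admissible_subset (by positivity) (by push_cast; linarith))
    (fun n => nonempty_admissible (by positivity)) hcomp
    (fun n => isClosed_admissible (by positivity))
  rw [mem_iInter] at hy₀
  have hmem := (hy₀ 0).1
  choose X hX using fun n : ℕ => exists_isTrajectory (P := P) (y₁_pos.le.trans hmem.1)
    (show (0 : ℝ) ≤ n + 1 by positivity)
  -- By uniqueness the trajectories on `[0, n + 1]` agree where they overlap, and index `⌊t⌋₊`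
  -- always covers `t`.
  have heq : ∀ n : ℕ, ∀ t ∈ Icc (0 : ℝ) (n + 1), X ⌊t⌋₊ t = X n t := by
    intro n t ht
    have h1 : t ∈ Icc (0 : ℝ) (⌊t⌋₊ + 1) := ⟨ht.1, (Nat.lt_floor_add_one t).le⟩
    rcases le_total (⌊t⌋₊ : ℝ) n with h | h
    · exact (hX _).eq ((hX n).restrict (by linarith)) h1
    · exact ((hX _).restrict (by linarith)).eq (hX n) ht
  refine ⟨y₀, hmem, fun t => X ⌊t⌋₊ t, fun T hT => ?_⟩
  have hT' : T ≤ ⌊T⌋₊ + 1 := (Nat.lt_floor_add_one T).le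
  have hx := (hX ⌊T⌋₊).restrict hT'
  have he : ∀ t ∈ Icc 0 T, X ⌊t⌋₊ t = X ⌊T⌋₊ t := fun t ht => heq _ t ⟨ht.1, ht.2.trans hT'⟩
  refine ⟨⟨?_, fun t ht => ?_, fun t ht => ?_, fun t ht => ?_⟩, fun t ht => ?_⟩
  · rw [he 0 ⟨le_rfl, hT⟩, hx.init]
  · simp only [he t ht]
    exact (hx.deriv_fst t ht).congr_of_mem (fun s hs => by rw [he s hs]) ht
  · simp only [he t ht]
    exact (hx.deriv_snd t ht).congr_of_mem (fun s hs => by rw [he s hs]) ht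
  · simp only [he t ht]
    exact hx.mem t ht
  · simp only [he t ht]
    exact (hy₀ _).2 _ (hX _) t ⟨ht.1, ht.2.trans hT'⟩

/-- The shooting problem has a solution in logarithmic time. -/
theorem exists_solution (P : ShootingProblem) :
    ∃ y₀ ∈ Ioo P.y₁ P.p₀, ∃ φ ψ : ℝ → ℝ, φ 0 = P.p₀ ∧ ψ 0 = (1 + P.l) * (P.p₀ - y₀) / P.p₀ ∧
      (∀ t, 0 ≤ t → 0 < φ t ∧ φ t ≤ P.p₀ ∧ 0 < ψ t ∧ ψ t < 1) ∧
      (∀ t, 0 ≤ t → HasDerivWithinAt φ (-(φ t * (1 - ψ t))) (Ici 0) t) ∧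
      ∀ t, 0 ≤ t → HasDerivWithinAt ψ
        (((1 - ψ t) * (P.κ * ψ t - P.ρ * P.k (φ t) - P.δ + P.R) + P.δ
          - P.R * (y₀ * Real.exp (-t)) / φ t) / P.κ) (Ici 0) t := by
  obtain ⟨y₀, hy₀, x, hx⟩ := P.exists_global_trajectory
  have hκ := P.κ_pos
  have hκl : 0 < P.κ * (1 + P.l) := mul_pos hκ (by linarith [P.l_pos])
  have hpos : ∀ t, 0 ≤ t → 0 < (x t).1 := fun t ht => (hx t ht).1.pos ⟨ht, le_rfl⟩
  have hle : ∀ t, 0 ≤ t → (x t).1 ≤ P.p₀ := fun t ht => ((hx t ht).1.mem t ⟨ht, le_rfl⟩).2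
  have hz0 : ∀ t, 0 ≤ t → 0 ≤ P.z (x t) := fun t ht => ((hx t ht).2 t ⟨ht, le_rfl⟩).1
  have hzle : ∀ t, 0 ≤ t → P.z (x t) ≤ P.κ * (x t).1 := fun t ht =>
    ((hx t ht).2 t ⟨ht, le_rfl⟩).2
  have hcl : ∀ t, 0 ≤ t → max 0 (min (P.z (x t)) (P.κ * (x t).1)) = P.z (x t) := fun t ht => by
    rw [min_eq_left (hzle t ht), max_eq_right (hz0 t ht)]
  have hIcc : ∀ t : ℝ, 0 ≤ t → Icc 0 (t + 1) ∈ 𝓝[Ici 0] t := fun t ht => by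
    rw [← Ici_inter_Iic]
    exact inter_mem_nhdsWithin _ (Iic_mem_nhds (by linarith))
  have hφ : ∀ t, 0 ≤ t → HasDerivWithinAt (fun t => (x t).1)
      (-((x t).1 - P.z (x t) / P.κ)) (Ici 0) t := by
    intro t ht
    have := (hx (t + 1) (by linarith)).1.deriv_fst t ⟨ht, by linarith⟩
    rw [hcl t ht] at this
    exact this.mono_of_mem_nhdsWithin (hIcc t ht)
  have hz : ∀ t, 0 ≤ t → HasDerivWithinAt (fun t => P.z (x t))
      (P.δ * (x t).1 - P.R * (y₀ * Real.exp (-t)) + (P.ρ * P.k (x t).1 + P.δ - P.R)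
        * -((x t).1 - P.z (x t) / P.κ)) (Ici 0) t := by
    intro t ht
    have := (hx (t + 1) (by linarith)).1.hasDerivWithinAt_z ⟨ht, by linarith⟩
    rw [hcl t ht] at this
    exact this.mono_of_mem_nhdsWithin (hIcc t ht)
  have hne_p₀ : y₀ ≠ P.p₀ := by
    rintro rfl
    obtain ⟨t, ht, h⟩ := (hx 1 zero_le_one).1.exists_z_neg one_pos
    exact h.not_ge (hz0 t ht.1)
  have hne_y₁ : y₀ ≠ P.y₁ := by
    rintro rfl
    obtain ⟨t, ht, h⟩ := (hx 1 zero_le_one).1.exists_gap_neg one_pos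
    linarith [hzle t ht.1]
  have hlt₁ : P.y₁ < y₀ := lt_of_le_of_ne hy₀.1 (Ne.symm hne_y₁)
  have hlt₂ : y₀ < P.p₀ := lt_of_le_of_ne hy₀.2 hne_p₀
  have hy₀pos : 0 < y₀ := y₁_pos.trans hlt₁
  have hx0 := (hx 0 le_rfl).1
  have hφ' : ∀ t, 0 < t → HasDerivAt (fun t => (x t).1) (-((x t).1 - P.z (x t) / P.κ)) t :=
    fun t ht => (hφ t ht.le).hasDerivAt (Ici_mem_nhds ht)
  have hz' : ∀ t, 0 < t → HasDerivAt (fun t => P.z (x t)) _ t :=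
    fun t ht => (hz t ht.le).hasDerivAt (Ici_mem_nhds ht)
  have hy' : ∀ t : ℝ, HasDerivAt (fun t => P.R * (y₀ * Real.exp (-t)))
      (-(P.R * (y₀ * Real.exp (-t)))) t := by
    intro t
    simpa using (((hasDerivAt_neg t).exp.const_mul y₀).const_mul P.R)
  have hk' : ∀ t, 0 < t → ContinuousAt (fun t => P.k (x t).1) t := fun t ht =>
    ContinuousAt.comp (f := fun t => (x t).1) (g := P.k)
      (P.continuousOn_k.continuousAt (Ioi_mem_nhds (hpos t ht.le))) (hφ' t ht).continuousAt
  have hRy : ∀ t : ℝ, 0 < P.R * (y₀ * Real.exp (-t)) := fun t =>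
    mul_pos P.R_pos (mul_pos hy₀pos (Real.exp_pos _))
  have hgap : ∀ t, 0 ≤ t → P.z (x t) < P.κ * (x t).1 := by
    intro t ht
    refine lt_of_le_of_ne (hzle t ht) fun heq => ?_
    rcases ht.eq_or_lt with rfl | ht
    · have := hx0.gap_zero
      rw [heq, sub_self] at this
      exact (mul_pos hκl (sub_pos.2 hlt₁)).ne this
    -- At a contact with `z = κ φ` one has `φ' = 0`, so the source `R y₀ e⁻ᵗ - δ φ` has derivative
    -- `-R y₀ e⁻ᵗ < 0`.
    · refine ne_zero_of_deriv_eq_add_mul (f := fun t => P.κ * (x t).1 - P.z (x t))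
        (S := fun t => P.R * (y₀ * Real.exp (-t)) - P.δ * (x t).1)
        (h := fun t => (P.ρ * P.k (x t).1 + P.δ - P.R) / P.κ - 1) ht
        (fun s hs => (((hφ' s hs).const_mul P.κ).sub (hz' s hs)).congr_deriv ?_)
        (fun s hs => sub_nonneg.2 (hzle s hs)) ?_ ((hy' t).sub ((hφ' t ht).const_mul P.δ)) ?_
        (by simp [heq])
      · field_simp
        ring
      · exact ((((hk' t ht).const_mul P.ρ).add_const P.δ).sub_const P.R).div_const P.κ
          |>.sub_const 1
      · rw [heq, mul_div_cancel_left₀ _ hκ.ne']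
        linarith [hRy t]
  -- Strictness puts `φ` where `k` is differentiable, as the contact argument at `z = 0` needs.
  have hlt : ∀ t, 0 < t → (x t).1 < P.p₀ := by
    intro t ht
    have hanti : StrictAntiOn (fun t => (x t).1) (Ici 0) := by
      refine strictAntiOn_of_deriv_neg (convex_Ici 0)
        (fun t ht => (hφ t ht).continuousWithinAt) fun s hs => ?_
      rw [interior_Ici] at hs
      rw [(hφ' s hs).deriv, neg_lt_zero, sub_pos, div_lt_iff₀' hκ]
      exact hgap s (le_of_lt hs)
    simpa [hx0.init] using hanti (mem_Ici.2 le_rfl) (mem_Ici.2 ht.le) ht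
  have hzpos : ∀ t, 0 ≤ t → 0 < P.z (x t) := by
    intro t ht
    refine lt_of_le_of_ne (hz0 t ht) fun heq => ?_
    rcases ht.eq_or_lt with rfl | ht
    · have := hx0.z_zero
      rw [← heq] at this
      exact (mul_pos hκl (sub_pos.2 hlt₂)).ne this
    · obtain ⟨d, hd, hkd⟩ := P.hasDerivAt_k _ ⟨hpos t ht.le, hlt t ht⟩
      have hS := (((hkd.comp t (hφ' t ht)).const_mul P.ρ).const_sub P.R |>.mul (hφ' t ht)).sub
        (hy' t)
      have hdz : ∀ s, 0 < s → HasDerivAt (fun t => P.z (x t))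
          ((P.R - P.ρ * P.k (x s).1) * (x s).1 - P.R * (y₀ * Real.exp (-s))
            + (P.ρ * P.k (x s).1 + P.δ - P.R) / P.κ * P.z (x s)) s := fun s hs =>
        (hz' s hs).congr_deriv (by field_simp; ring)
      have hmin : IsLocalMin (fun t => P.z (x t)) t := by
        filter_upwards [Ioi_mem_nhds ht] with s hs
        rw [← heq]; exact hz0 s (le_of_lt hs)
      have hS0 := hmin.hasDerivAt_eq_zero (hdz t ht)
      rw [← heq, mul_zero, add_zero] at hS0
      refine ne_zero_of_deriv_eq_add_mul (f := fun t => P.z (x t))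
        (S := fun t => (P.R - P.ρ * P.k (x t).1) * (x t).1 - P.R * (y₀ * Real.exp (-t)))
        (h := fun t => (P.ρ * P.k (x t).1 + P.δ - P.R) / P.κ) ht hdz hz0 ?_ hS ?_ heq.symm
      · exact (((hk' t ht).const_mul P.ρ).add_const P.δ |>.sub_const P.R).div_const P.κ
      -- At a contact with `z = 0` one has `φ' = -φ`; since the source itself vanishes there, its
      -- derivative reduces to `ρ k'(φ) φ² < 0`.
      · have hneg : P.ρ * d * (x t).1 ^ 2 < 0 :=
          mul_neg_of_neg_of_pos (mul_neg_of_pos_of_neg P.ρ_pos hd) (pow_pos (hpos t ht.le) 2)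
        simp only [← heq, zero_div, sub_zero, Function.comp]
        linarith
  refine ⟨y₀, ⟨hlt₁, hlt₂⟩, fun t => (x t).1, fun t => P.z (x t) / (P.κ * (x t).1), ?_, ?_,
    fun t ht => ⟨hpos t ht, hle t ht, div_pos (hzpos t ht) (mul_pos hκ (hpos t ht)),
      (div_lt_one (mul_pos hκ (hpos t ht))).2 (hgap t ht)⟩, fun t ht => ?_, fun t ht => ?_⟩
  · simp [hx0.init]
  · have := P.p₀_pos.ne'
    change P.z (x 0) / (P.κ * (x 0).1) = _
    rw [hx0.z_zero, hx0.init]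
    field_simp
  · have := (hpos t ht).ne'
    refine (hφ t ht).congr_deriv ?_
    field_simp
  · have := (hpos t ht).ne'
    refine ((hz t ht).div ((hφ t ht).const_mul P.κ) (mul_pos hκ (hpos t ht)).ne').congr_deriv ?_
    field_simp
    ring

end ShootingProblem
end

noncomputable section

/-! ### Return to the variable `y`. -/

namespace HabitModel

open IsUtility

variable {M : HabitModel}

/-- The shooting problem of the model. -/
def shootingProblem (hr : 0 ≤ M.r) (hμ : 0 < M.μ) (hσ : 0 < M.σ) (hρ : 0 < M.ρ) (hδ : 0 < M.δ)
    (hα : 0 < M.α) (hUp : IsUtility M.Up) {x : ℝ} (hx : x ∈ steep M.Up)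
    (hφ₀ : M.φ₀ = marginal M.Up x) : ShootingProblem where
  κ := M.μ ^ 2 / (2 * M.σ ^ 2)
  ρ := M.ρ
  δ := M.δ
  R := M.r + M.ρ
  l := -M.lam
  p₀ := M.φ₀
  -- Freezing the argument at `φ₀` makes `k` continuous and antitone on all of `(0, ∞)`, without
  -- changing it on the range of `φ`.
  k p := M.α + marginalInv M.Up (min p M.φ₀)
  κ_pos := by positivity
  ρ_pos := hρ
  δ_pos := hδ
  R_pos := by positivity
  l_pos := neg_pos.2 (lam_neg hμ hσ hδ)
  p₀_pos := hφ₀ ▸ hx.2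
  quadratic := by linear_combination lam_quadratic (M := M) hμ hσ hδ
  k_pos := by
    rw [min_self, hφ₀, hUp.marginalInv_marginal hx]
    linarith [hx.1]
  continuousOn_k := by
    refine continuousOn_const.add (ContinuousOn.comp (hUp.continuousOn_marginalInv hx)
      (by fun_prop) fun p hp => ⟨lt_min hp (hφ₀ ▸ hx.2), hφ₀ ▸ min_le_right _ _⟩)
  antitoneOn_k := by
    intro p hp q hq h
    have hpos : 0 < M.φ₀ := hφ₀ ▸ hx.2
    have := (hUp.strictAntiOn_marginalInv hx).antitoneOn
      ⟨lt_min hp hpos, hφ₀ ▸ min_le_right _ _⟩ ⟨lt_min hq hpos, hφ₀ ▸ min_le_right _ _⟩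
      (min_le_min_right M.φ₀ h)
    exact add_le_add_right this M.α
  hasDerivAt_k := by
    rintro p ⟨hp, hpφ⟩
    obtain ⟨d, hd, h⟩ := hUp.hasDerivAt_marginalInv hx hp (hφ₀ ▸ hpφ)
    refine ⟨d, hd, HasDerivAt.congr_of_eventuallyEq (h.const_add M.α) ?_⟩
    filter_upwards [Iio_mem_nhds hpφ] with q hq
    rw [min_eq_left (le_of_lt hq)]

theorem exists_isSystemSolution (hr : 0 ≤ M.r) (hμ : 0 < M.μ) (hσ : 0 < M.σ) (hρ : 0 < M.ρ)
    (hδ : 0 < M.δ) (hα : 0 < M.α) (hUp : IsUtility M.Up) {x : ℝ} (hx : x ∈ steep M.Up)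
    (hφ₀ : M.φ₀ = marginal M.Up x) : ∃ y₀ φ ψ, M.IsSystemSolution y₀ φ ψ := by
  set P := shootingProblem hr hμ hσ hρ hδ hα hUp hx hφ₀ with hP
  obtain ⟨y₀, hy₀, φ, ψ, hφ0, hψ0, hmem, hφ, hψ⟩ := P.exists_solution
  have hφ₀pos : 0 < M.φ₀ := hφ₀ ▸ hx.2
  have hlam := lam_neg (M := M) hμ hσ hδ
  have hy₀pos : 0 < y₀ := ShootingProblem.y₁_pos.trans hy₀.1
  have ht : MapsTo (fun y => Real.log (y₀ / y)) (Ioc 0 y₀) (Ici 0) := fun y hy =>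
    Real.log_nonneg ((one_le_div hy.1).2 hy.2)
  have hexp : ∀ y ∈ Ioc 0 y₀, y₀ * Real.exp (-Real.log (y₀ / y)) = y := by
    intro y hy
    rw [Real.exp_neg, Real.exp_log (div_pos hy₀pos hy.1), inv_div, mul_div_cancel₀ _ hy₀pos.ne']
  have hlog : ∀ y ∈ Ioc 0 y₀,
      HasDerivWithinAt (fun y => Real.log (y₀ / y)) (-(1 / y)) (Ioc 0 y₀) y := by
    intro y hy
    have := (Real.hasDerivAt_log hy.1.ne').hasDerivWithinAt (s := Ioc 0 y₀) |>.const_sub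
      (Real.log y₀)
    refine (this.congr_deriv (by rw [one_div])).congr_of_mem (fun z hz => ?_) hy
    exact Real.log_div hy₀pos.ne' hz.1.ne'
  have hdφ : ∀ y ∈ Ioc 0 y₀, HasDerivWithinAt (fun y => φ (Real.log (y₀ / y)))
      (1 / y * φ (Real.log (y₀ / y)) * (1 - ψ (Real.log (y₀ / y)))) (Ioc 0 y₀) y := by
    intro y hy
    refine (HasDerivWithinAt.comp (h₂ := φ) y (hφ _ (ht hy)) (hlog y hy) ht).congr_deriv ?_
    ring
  have hmono : StrictMonoOn (fun y => φ (Real.log (y₀ / y))) (Ioc 0 y₀) := by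
    refine strictMonoOn_of_deriv_pos (convex_Ioc 0 y₀)
      (fun y hy => (hdφ y hy).continuousWithinAt) fun y hy => ?_
    rw [interior_Ioc] at hy
    rw [((hdφ y (Ioo_subset_Ioc_self hy)).hasDerivAt (Ioc_mem_nhds hy.1 hy.2)).deriv]
    have h := hmem _ (ht (Ioo_subset_Ioc_self hy))
    have := hy.1
    have := h.1
    have := sub_pos.2 h.2.2.2
    positivity
  have hbφ : φ (Real.log (y₀ / y₀)) = M.φ₀ := by
    rw [div_self hy₀pos.ne', Real.log_one]; exact hφ0
  have hl1 : M.lam - 1 ≠ 0 := by linarith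
  have hκ : M.μ ^ 2 / (2 * M.σ ^ 2) ≠ 0 := by positivity
  refine ⟨y₀, fun y => φ (Real.log (y₀ / y)), fun y => ψ (Real.log (y₀ / y)), ?_,
    fun y hy => ⟨(hmem _ (ht hy)).1, (hmem _ (ht hy)).2.1⟩, fun y hy => ?_, hmono,
    fun y hy => (hmem _ (ht hy)).2.2, hdφ, fun y hy => ?_, hbφ, ?_⟩
  · have hy₁ : M.φ₀ * M.lam / (M.lam - 1) = P.y₁ := by
      simp only [hP, ShootingProblem.y₁, shootingProblem]
      rw [div_eq_div_iff hl1 (by linarith)]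
      ring
    rw [hy₁]
    exact hy₀
  · rw [← hbφ]
    exact hmono (Ioo_subset_Ioc_self hy) ⟨hy₀pos, le_rfl⟩ hy.2
  · refine (HasDerivWithinAt.comp (h₂ := ψ) y (hψ _ (ht hy)) (hlog y hy) ht).congr_deriv ?_
    have h := hmem _ (ht hy)
    rw [hexp y hy]
    simp only [hP, shootingProblem]
    have hle : φ (Real.log (y₀ / y)) ≤ M.φ₀ := h.2.1
    rw [min_eq_left hle]
    have : φ (Real.log (y₀ / y)) ≠ 0 := h.1.ne'
    have := hy.1.ne'
    field_simp
    ring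
  · simp only [div_self hy₀pos.ne', Real.log_one, hψ0]
    simp only [hP, shootingProblem]
    have hq := lam_quadratic (M := M) hμ hσ hδ
    have hne := hlam.ne
    -- The quadratic divided by `λ`; it matches the prescribed `ψ(y₀)` with the initial value `(1 -
    -- λ) (φ₀ - y₀) / φ₀`.
    have h1 : M.δ / M.lam + M.r + M.ρ - M.δ = M.μ ^ 2 / (2 * M.σ ^ 2) * (M.lam - 1) := by
      field_simp at hq ⊢
      linear_combination -hq
    rw [h1]
    field_simp
    ring

end HabitModel

end

theorem theorem3p1 (M : HabitModel)
    (hr : 0 ≤ M.r) (hμ : 0 < M.μ) (hσ : 0 < M.σ) (hρ : 0 < M.ρ) (hδ : 0 < M.δ)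
    (hα : 0 < M.α) (hα1 : M.α ≤ 1)
    (hUp : IsUtility M.Up) (hUm : IsUtility M.Um)
    (hLA : ((M.Um M.α : ℝ) : EReal) ≤ ((M.α : ℝ) : EReal) * slopeAtZero M.Up) :
    (∃ (y₀ : ℝ) (φ ψ : ℝ → ℝ), M.IsSystemSolution y₀ φ ψ) ∧
    ∀ (y₀ : ℝ) (φ ψ : ℝ → ℝ), M.IsSystemSolution y₀ φ ψ →
      (∃ φ0 : ℝ, Tendsto φ (𝓝[>] 0) (𝓝 φ0) ∧ (0 < φ0 ∨ Tendsto ψ (𝓝[>] 0) (𝓝 1))) ∧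
      M.IsReducedDualSolution (M.dualFun φ ψ) y₀ ∧
      (∀ y ∈ Ioo 0 y₀, HasDerivAt (M.dualFun φ ψ) ((y - φ y) / (M.ρ * y)) y) ∧
      (∀ y ∈ Ioo 0 y₀,
        HasDerivAt (deriv (M.dualFun φ ψ)) (1 / (M.ρ * y ^ 2) * φ y * ψ y) y) ∧
      StrictAntiOn (M.dualFun φ ψ) (Ioo 0 y₀) ∧
      StrictConvexOn ℝ (Ioo 0 y₀) (M.dualFun φ ψ) ∧
      Tendsto (deriv (M.dualFun φ ψ)) (𝓝[>] 0) atBot := by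
  obtain ⟨x, hx, hφ₀, hG⟩ := HabitModel.exists_φ₀_eq hα hUp hUm hLA
  have hlam := HabitModel.lam_neg (M := M) hμ hσ hδ
  refine ⟨HabitModel.exists_isSystemSolution hr hμ hσ hρ hδ hα hUp hx hφ₀, fun y₀ φ ψ h => ?_⟩
  have hy₀ := h.y₀_pos (hφ₀ ▸ hx.2) hlam
  exact ⟨h.exists_limit hr hμ hσ hρ hδ hy₀ hUp hx hφ₀,
    h.isReducedDualSolution hμ hσ hρ hδ hlam hUp hx hφ₀ hG,
    fun y hy => h.hasDerivAt_dualFun hμ hσ hρ hδ hUp hx hφ₀ hy,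
    fun y hy => h.hasDerivAt_deriv_dualFun hμ hσ hρ hδ hUp hx hφ₀ hy,
    h.strictAntiOn_dualFun hμ hσ hρ hδ hUp hx hφ₀,
    h.strictConvexOn_dualFun hμ hσ hρ hδ hUp hx hφ₀,
    h.tendsto_deriv_dualFun hr hμ hσ hρ hδ hy₀ hUp hx hφ₀⟩
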